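/- Let $\Theta$ be a (nonempty) Polish space with a metric. All base measures below are locally finite, i.e. finite on sets of bounded diameter, and $\mathrm{BM}_+(\Theta)$ is the set of bounded measurable functions $f:\Theta\to[0,\infty)$ with bounded support. For a locally finite measure $H$ and a rate $r>0$, $W\sim\mathrm{GaP}(H,r)$ means that $W$ is an (almost surely) locally finite random measure with $$\mathrm E\,e^{-\int f\,dW}=\exp\Big(-\int_\Theta\log\big(1+f/r\big)\,dH\Big),\qquad f\in \mathrm{BM}_+(\Theta).$$ For $c>0$, $W\sim\mathrm{NcGaP}(H,M,c^{-1})$ means that $W$ is an (almost surely) locally finite random measure with $$\mathrm E\,e^{-\int f\,dW}=\exp\Big(-\int_\Theta\log(1+cf)\,dH-\int_\Theta\frac{cf}{1+cf}\,dM\Big),\qquad f\in \mathrm{BM}_+(\Theta).$$ For $b\ge 0$ and $c>0$, the noncentral gamma-zero law $\mathrm{NcGa}(0,b,c^{-1})$ is the law of $Y$, where $Z\sim\mathrm{Poisson}(b)$ and, given $Z$, $Y$ has the gamma distribution with shape $Z$ and rate $c^{-1}$ (the Dirac mass at $0$ if $Z=0$). Let $H$ be a locally finite measure on $\Theta$,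 let $\beta_s,c_s>0$ for $s\ge2$, and let $(W_s)_{s\ge1}$ be an M-ARG(1) process: a Markov process of (almost surely) locally finite random measures on $\Theta$, with an arbitrary (possibly random) initial measure $W_1$, such that for every $s\ge1$ the conditional law of $W_{s+1}$ given $W_1,\dots,W_s$ depends only on $W_s$ and is $\mathrm{NcGaP}(H,\beta_{s+1}W_s,c_{s+1}^{-1})$. Fix $t\ge1$; if $t=1$, assume that $W_1=\sum_{i\ge1}w_i\delta_{\theta_i}$ almost surely for some random variables $w_i\ge0$ and $\theta_i\in\Theta$. Then: 1. On a suitable extension of the probability space there are random variables $w_{i,t}\ge0$, $\theta_{i,t}\in\Theta$ and $w^{(U)}_{i,t+1}\ge0$ ($i\ge1$) and a random measure $W^{(I)}_{t+1}$ such that (a) $W_t=\sum_{i\ge1}w_{i,t}\,\delta_{\theta_{i,t}}$ almost surely; (b) conditionally on $W_1,\dots,W_t$ and on all $w_{i,t},\theta_{i,t}$, the variables $w^{(U)}_{i,t+1}$ are independent with laws $\mathrm{NcGa}(0,\beta_{t+1}w_{i,t},c_{t+1}^{-1})$; (c) $W^{(I)}_{t+1}\sim\mathrm{GaP}(H,c_{t+1}^{-1})$,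 and $W^{(I)}_{t+1}$ is independent of the collection consisting of $W_1,\dots,W_t$ and all $w_{i,t},\theta_{i,t},w^{(U)}_{i,t+1}$. 2. For every choice of such objects, over the given past $(W_1,\dots,W_t)$ or over any random vector with the same law, put $(\beta_{t+1},c_{t+1})\odot W_t=\sum_{i\ge1}w^{(U)}_{i,t+1}\,\delta_{\theta_{i,t}}$. Then $$W_{t+1}\mid W_t\ \stackrel{\mathscr L}{=}\ (\beta_{t+1},c_{t+1})\odot W_t+W^{(I)}_{t+1},$$ and indeed $\big(W_1,\dots,W_t,\ (\beta_{t+1},c_{t+1})\odot W_t+W^{(I)}_{t+1}\big)$ has the same joint law as $(W_1,\dots,W_t,W_{t+1})$. Moreover, each atom weight dies with probability $$\Pr\{w^{(U)}_{i,t+1}=0\mid w_{i,t}\}=e^{-\beta_{t+1}w_{i,t}}\quad\text{almost surely},\qquad i\ge1.$$ -/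

import Mathlib

open MeasureTheory ProbabilityTheory
open scoped NNReal ENNReal

universe u v x

noncomputable section

namespace MARG

/-! ### Scalar laws -/

/-- The gamma distribution with shape `a` and rate `r`; for shape `0` it is the Dirac mass at `0`. -/
def gammaLaw (a r : ℝ) : Measure ℝ :=
  if a = 0 then Measure.dirac 0 else gammaMeasure a r

/-- The noncentral gamma distribution `NcGa(δ, b, r)`: the mixture of the gamma laws with shape
`δ + n` and rate `r`, where `n` is Poisson distributed with mean `b`.
For `δ = 0` it is the noncentral gamma-zero distribution. -/
def ncGammaLaw (δ : ℝ) (b : ℝ≥0) (r : ℝ) : Measure ℝ :=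
  Measure.sum fun n : ℕ => poissonMeasure b {n} • gammaLaw (δ + n) r

/-- The past `(W_1, …, W_t)` of a process. -/
def past {Ω Θ : Type*} [MeasurableSpace Θ] (W : ℕ → Ω → Measure Θ) (t : ℕ) (ω : Ω) : Set.Icc 1 t → Measure Θ :=
  fun s => W s ω

/-- The last state `W_t` of a past `(W_1, …, W_t)`, for `1 ≤ t`. -/
def lastState {Θ : Type*} [MeasurableSpace Θ] {t : ℕ} (ht : 1 ≤ t) (h : Set.Icc 1 t → Measure Θ) : Measure Θ :=
  h ⟨t, ht, le_rfl⟩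

theorem measurable_lastState {Θ : Type*} [MeasurableSpace Θ] {t : ℕ} (ht : 1 ≤ t) :
    Measurable (lastState (Θ := Θ) ht) :=
  measurable_pi_apply _

section RandomMeasures

variable {Θ : Type*} [MetricSpace Θ] [MeasurableSpace Θ]

/-- A measure that is finite on sets of bounded diameter. -/
def FiniteOnBounded (m : Measure Θ) : Prop :=
  ∀ s : Set Θ, Bornology.IsBounded s → m s < ∞

/-- The measurable nonnegative bounded functions with bounded support. -/
def BMPlus (Θ : Type*) [MetricSpace Θ] [MeasurableSpace Θ] : Set (Θ → ℝ) :=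
  {f | Measurable f ∧ (∀ x, 0 ≤ f x) ∧ (∃ C : ℝ, ∀ x, f x ≤ C) ∧
    Bornology.IsBounded (Function.support f)}

/-- `Q` is the law of a gamma random measure with base measure `H` and rate `r`. -/
structure IsGammaProcessLaw (H : Measure Θ) (r : ℝ) (Q : Measure (Measure Θ)) : Prop where
  isProbabilityMeasure : IsProbabilityMeasure Q
  finiteOnBounded : ∀ᵐ m ∂Q, FiniteOnBounded m
  laplace : ∀ f ∈ BMPlus Θ,
    ∫ m, Real.exp (-∫ x, f x ∂m) ∂Q = Real.exp (-∫ x, Real.log (1 + f x / r) ∂H)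

/-- `Q` is the law of a noncentral gamma random measure `NcGaP(H, M, r)`; the scale is
`c = r⁻¹`. -/
structure IsNcGammaProcessLaw (H M : Measure Θ) (r : ℝ) (Q : Measure (Measure Θ)) : Prop where
  isProbabilityMeasure : IsProbabilityMeasure Q
  finiteOnBounded : ∀ᵐ m ∂Q, FiniteOnBounded m
  laplace : ∀ f ∈ BMPlus Θ,
    ∫ m, Real.exp (-∫ x, f x ∂m) ∂Q =
      Real.exp (-(∫ x, Real.log (1 + r⁻¹ * f x) ∂H)
        - ∫ x, r⁻¹ * f x / (1 + r⁻¹ * f x) ∂M)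

/-- `(W_t)_{t ≥ 1}` is an M-ARG(1) process: a Markov process of measures finite on bounded sets,
such that a regular conditional law of `W_{t+1}` given the past `(W_1, …, W_t)` is a function of
`W_t` only, namely `NcGaP(H, β_{t+1} W_t, c_{t+1}⁻¹)`. The value `W 0` plays no role. -/
structure IsMARG1 {Ω : Type*} [MeasurableSpace Ω] (P : Measure Ω) (H : Measure Θ)
    (β c : ℕ → ℝ≥0) (W : ℕ → Ω → Measure Θ) : Prop where
  base : FiniteOnBounded H
  β_pos : ∀ t, 2 ≤ t → 0 < β t
  c_pos : ∀ t, 2 ≤ t → 0 < c t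
  measurable : ∀ t, 1 ≤ t → Measurable (W t)
  finiteOnBounded : ∀ t, 1 ≤ t → ∀ᵐ ω ∂P, FiniteOnBounded (W t ω)
  transition : ∀ (t : ℕ) (ht : 1 ≤ t),
    ∃ κ : Kernel (Measure Θ) (Measure Θ), IsMarkovKernel κ ∧
      (∀ᵐ m ∂(P.map (W t)),
        IsNcGammaProcessLaw H (β (t + 1) • m) ((c (t + 1) : ℝ)⁻¹) (κ m)) ∧
      HasCondDistrib (W (t + 1)) (past W t)
        (κ.comap (lastState ht) (measurable_lastState ht)) P

/-- The purely atomic measure `∑ i, w_i δ_{θ_i}` (weights equal to `0` are allowed, so this covers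
finite sums as well). -/
def atomicMeasure (w : ℕ → ℝ≥0) (θ : ℕ → Θ) : Measure Θ :=
  Measure.sum fun i => (w i : ℝ≥0∞) • Measure.dirac (θ i)

/-- The random measure `X` can be written as `∑ i, w_i δ_{θ_i}` with random variables
`w_i ≥ 0` and `θ_i`. -/
def IsAtomic {Ω : Type*} [MeasurableSpace Ω] (P : Measure Ω) (X : Ω → Measure Θ) : Prop :=
  ∃ (w : ℕ → Ω → ℝ≥0) (θ : ℕ → Ω → Θ), (∀ i, Measurable (w i)) ∧ (∀ i, Measurable (θ i)) ∧
    ∀ᵐ ω ∂P, X ω = atomicMeasure (fun i => w i ω) (fun i => θ i ω)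

/-- Given the σ-algebra `𝓖`, the variables `wU i` are independent, and `wU i` has the
noncentral gamma-zero law `NcGa(0, b w_i, r)`. -/
def IsThinnedWeights {Ω : Type*} [MeasurableSpace Ω] (P : Measure Ω) (𝓖 : MeasurableSpace Ω)
    (b : ℝ≥0) (r : ℝ) (w wU : ℕ → Ω → ℝ≥0) : Prop :=
  ∀ (S : Finset ℕ) (B : ℕ → Set ℝ), (∀ i, MeasurableSet (B i)) →
    P⟦⋂ i ∈ S, {ω | (wU i ω : ℝ) ∈ B i} | 𝓖⟧ =ᵐ[P]
      fun ω => ∏ i ∈ S, (ncGammaLaw 0 (b * w i ω) r).real (B i)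

/-- The right-hand side of the autoregressive representation, built over a past `(X_1, …, X_t)`:
the last state is `X_t = ∑ i, w_i δ_{θ_i}`; given the past and the atoms, the thinned weights
`wU i` are independent with laws `NcGa(0, b w_i, c⁻¹)`; and the innovation `WI` has the law
`GaP(H, c⁻¹)` and is independent of the past, the atoms and the thinned weights. -/
structure IsThinningWithInnovation {Ω : Type*} [MeasurableSpace Ω] (P : Measure Ω)
    (H : Measure Θ) (b c : ℝ≥0) (t : ℕ) (X : ℕ → Ω → Measure Θ)
    (w : ℕ → Ω → ℝ≥0) (θ : ℕ → Ω → Θ) (wU : ℕ → Ω → ℝ≥0) (WI : Ω → Measure Θ) : Prop where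
  measurable_past : ∀ s, 1 ≤ s → s ≤ t → Measurable (X s)
  measurable_weight : ∀ i, Measurable (w i)
  measurable_atom : ∀ i, Measurable (θ i)
  measurable_thinned : ∀ i, Measurable (wU i)
  measurable_innovation : Measurable WI
  atomic : ∀ᵐ ω ∂P, X t ω = atomicMeasure (fun i => w i ω) (fun i => θ i ω)
  thinned : IsThinnedWeights P
    (MeasurableSpace.comap (fun ω => (past X t ω, (fun i => w i ω), (fun i => θ i ω)))
      inferInstance) b ((c : ℝ)⁻¹) w wU
  innovation : IsGammaProcessLaw H ((c : ℝ)⁻¹) (P.map WI)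
  indep : IndepFun WI
    (fun ω => (past X t ω, (fun i => w i ω), (fun i => θ i ω), (fun i => wU i ω))) P

end RandomMeasures

end MARG

end

noncomputable section

namespace MARG

open Filter Topology

/-! The representation is a factorisation of Laplace functionals. Given the past, the functional of
`W_{t+1}` at `f` is `exp(-∫ log(1+cf) dH) · exp(-β ∫ cf/(1+cf) dW_t)`. The first factor belongs to
the innovation. If `W_t = ∑ w_i δ_{θ_i}`, the second is the product over `i` of `exp(-β w_i ·
cs/(1+cs))` at `s = f(θ_i)`. Each of these is the Laplace transform of `NcGa(0, β w_i, c⁻¹)`: a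
gamma variable of shape `n` and rate `c⁻¹` has transform `q^n` with `q = 1/(1+cs)`, and a Poisson
number `N` of mean `b` has `E q^N = e^{-b(1-q)}` (`lintegral_negExp_ncGammaLaw_zero`). The two sides
therefore have the same functional on every event of the past (`IsMARG1.laplace_next`,
`IsThinningWithInnovation.laplace`), and Laplace functionals determine laws of locally finite random
measures (`ext_of_laplaceFunctional`), so the joint laws agree. A weight dies exactly when its
Poisson number is zero, up to null events.

Existence needs atoms of `W_t`. For `t ≥ 2` the transition law is known only through its Laplace
functional, so a version is built as a Poisson series of atoms (`exists_ncGammaProcess`). An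
exponential mark of mean `v` contributes `vf/(1+vf)` to the exponent; the identity `log(1+x) = ∫₀¹
ux/(1+ux) du/u` shows that the gamma part arises from the same marks with random scale. By
uniqueness, `W_t` has the law of a random atomic measure (`IsMARG1.exists_atoms_law`), and atoms can
be sampled given `W_t` from a regular conditional law (`exists_atoms_kernel`). Thinned weights are
then functions of the atoms and independent uniforms.

The conditional description of thinned weights is equivalent to one equality of joint laws with such
a coupling (`isThinnedWeights_iff_map_eq`). One direction builds the objects; the other computes
with arbitrary given ones. -/

/-! ### The exponential on `[0, ∞]` and Laplace transforms of independent series. -/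

/-- The decreasing exponential `x ↦ e^{-x}` on `[0, ∞]`, with value `0` at `∞`. -/
def negExp (x : ℝ≥0∞) : ℝ≥0∞ := EReal.exp (-(x : EReal))

@[simp] lemma negExp_zero : negExp 0 = 1 := by simp [negExp]

@[simp] lemma negExp_top : negExp ∞ = 0 := by simp [negExp]

lemma negExp_coe (x : ℝ≥0) : negExp x = ENNReal.ofReal (Real.exp (-x)) := by
  rw [negExp, ← EReal.exp_coe]
  rfl

lemma negExp_ofReal {x : ℝ} (hx : 0 ≤ x) :
    negExp (ENNReal.ofReal x) = ENNReal.ofReal (Real.exp (-x)) := by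
  rw [ENNReal.ofReal, negExp_coe, Real.coe_toNNReal x hx]

lemma negExp_add (x y : ℝ≥0∞) : negExp (x + y) = negExp x * negExp y := by
  rw [negExp, EReal.coe_ennreal_add, EReal.neg_add (by simp) (by simp), sub_eq_add_neg,
    EReal.exp_add]
  rfl

lemma continuous_negExp : Continuous negExp :=
  ENNReal.continuous_exp.comp (continuous_neg.comp continuous_coe_ennreal_ereal)

@[fun_prop]
lemma measurable_negExp : Measurable negExp := continuous_negExp.measurable

lemma negExp_le_one (x : ℝ≥0∞) : negExp x ≤ 1 := by
  simpa [negExp] using EReal.coe_ennreal_nonneg x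

lemma negExp_ne_top (x : ℝ≥0∞) : negExp x ≠ ∞ :=
  ((negExp_le_one x).trans_lt ENNReal.one_lt_top).ne

lemma negExp_antitone : Antitone negExp := fun x y h => by
  simpa [negExp] using h

lemma negExp_sum {ι : Type*} (s : Finset ι) (a : ι → ℝ≥0∞) :
    negExp (∑ i ∈ s, a i) = ∏ i ∈ s, negExp (a i) := by
  classical
  induction s using Finset.induction_on with
  | empty => simp
  | insert i s hi ih => rw [Finset.sum_insert hi, Finset.prod_insert hi, negExp_add, ih]

lemma negExp_nat_mul (k : ℕ) (x : ℝ≥0∞) : negExp (k * x) = negExp x ^ k := by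
  simpa using negExp_sum (Finset.range k) (fun _ => x)

lemma exists_negExp_eq {y : ℝ≥0∞} (hy : y ≤ 1) : ∃ x, negExp x = y := by
  refine ⟨(-(ENNReal.log y)).toENNReal, ?_⟩
  have h : 0 ≤ -(ENNReal.log y) := by
    rw [EReal.neg_nonneg]
    simpa using ENNReal.log_le_log_iff.2 hy
  rw [negExp, EReal.coe_toENNReal h, neg_neg, ENNReal.exp_log]

/-- Continuity of `negExp` at `∞` makes this hold for divergent series too, so no convergence of
random series ever has to be checked. -/
lemma tendsto_negExp_tsum (a : ℕ → ℝ≥0∞) :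
    Tendsto (fun n => ∏ i ∈ Finset.range n, negExp (a i)) atTop (𝓝 (negExp (∑' i, a i))) := by
  simp_rw [← negExp_sum]
  exact (continuous_negExp.tendsto _).comp ENNReal.summable.hasSum.tendsto_sum_nat

lemma lintegral_negExp_le_measure_univ {α : Type*} [MeasurableSpace α] (μ : Measure α)
    (F : α → ℝ≥0∞) : ∫⁻ a, negExp (F a) ∂μ ≤ μ Set.univ := by
  calc ∫⁻ a, negExp (F a) ∂μ ≤ ∫⁻ _, 1 ∂μ := lintegral_mono fun a => negExp_le_one _
    _ = μ Set.univ := by simp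

lemma lintegral_prod_infinitePi {X : ℕ → Type*} [∀ i, MeasurableSpace (X i)]
    (μ : ∀ i, Measure (X i)) [∀ i, IsProbabilityMeasure (μ i)] (s : Finset ℕ)
    (F : ∀ i, X i → ℝ≥0∞) (hF : ∀ i, Measurable (F i)) :
    ∫⁻ u, ∏ i ∈ s, F i (u i) ∂(Measure.infinitePi μ) = ∏ i ∈ s, ∫⁻ x, F i x ∂(μ i) := by
  refine (lintegral_prod_eq_prod_lintegral_of_indepFun s (fun i (u : ∀ i, X i) => F i (u i))
    (iIndepFun_infinitePi (P := μ) (X := F) hF)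
    (fun i => (hF i).comp (measurable_pi_apply i))).trans ?_
  refine Finset.prod_congr rfl fun i _ => ?_
  exact (measurePreserving_eval_infinitePi μ i).lintegral_comp (hF i)

/-- Laplace transform of a series of independent variables. -/
lemma lintegral_negExp_tsum_infinitePi {X : ℕ → Type*} [∀ i, MeasurableSpace (X i)]
    (μ : ∀ i, Measure (X i)) [∀ i, IsProbabilityMeasure (μ i)]
    (F : ∀ i, X i → ℝ≥0∞) (hF : ∀ i, Measurable (F i)) (C : ℕ → ℝ≥0∞)
    (hC : ∀ i, ∫⁻ x, negExp (F i x) ∂(μ i) = negExp (C i)) :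
    ∫⁻ u, negExp (∑' i, F i (u i)) ∂(Measure.infinitePi μ) = negExp (∑' i, C i) := by
  have h1 : Tendsto (fun n => ∫⁻ u, ∏ i ∈ Finset.range n, negExp (F i (u i))
      ∂(Measure.infinitePi μ)) atTop
      (𝓝 (∫⁻ u, negExp (∑' i, F i (u i)) ∂(Measure.infinitePi μ))) := by
    refine tendsto_lintegral_of_dominated_convergence (fun _ => 1) (fun n => ?_) (fun n => ?_)
      (by simp) ?_
    · exact Finset.measurable_prod _ fun i _ =>
        measurable_negExp.comp ((hF i).comp (measurable_pi_apply i))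
    · filter_upwards with u
      exact Finset.prod_le_one' fun i _ => negExp_le_one _
    · filter_upwards with u
      exact tendsto_negExp_tsum _
  refine tendsto_nhds_unique h1 ?_
  have h2 : ∀ n, ∫⁻ u, ∏ i ∈ Finset.range n, negExp (F i (u i)) ∂(Measure.infinitePi μ) =
      ∏ i ∈ Finset.range n, negExp (C i) := by
    intro n
    rw [lintegral_prod_infinitePi μ _ (fun i x => negExp (F i x))
      (fun i => measurable_negExp.comp (hF i))]
    simp_rw [hC]
  simp_rw [h2]
  exact tendsto_negExp_tsum _

/-! ### Uniqueness of Laplace transforms on the orthant. -/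

section LaplaceUniqueness

variable {ι : Type*} [Fintype ι]

/-- The function `x ↦ e^{-⟨s, x⟩}` on the positive orthant. -/
def orthantExp (s : ι → ℝ≥0) : BoundedContinuousFunction (ι → ℝ≥0) ℝ :=
  BoundedContinuousFunction.ofNormedAddCommGroup
    (fun x => Real.exp (-∑ i, (s i : ℝ) * x i)) (by fun_prop) 1 (fun x => by
      rw [Real.norm_eq_abs, Real.abs_exp, Real.exp_le_one_iff, neg_nonpos]
      positivity)

lemma orthantExp_apply (s x : ι → ℝ≥0) :
    orthantExp s x = Real.exp (-∑ i, (s i : ℝ) * x i) := rfl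

/-- The exponentials `orthantExp` form a monoid under multiplication. -/
def orthantExpSubmonoid (ι : Type*) [Fintype ι] :
    Submonoid (BoundedContinuousFunction (ι → ℝ≥0) ℝ) where
  carrier := Set.range orthantExp
  mul_mem' := by
    rintro _ _ ⟨s, rfl⟩ ⟨s', rfl⟩
    refine ⟨s + s', ?_⟩
    ext x
    simp [orthantExp_apply, add_mul, Finset.sum_add_distrib, Real.exp_add, mul_comm]
  one_mem' := ⟨0, by ext x; simp [orthantExp_apply]⟩

/-- The algebra spanned by the exponentials `orthantExp`. -/
def orthantExpAlgebra (ι : Type*) [Fintype ι] :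
    StarSubalgebra ℝ (BoundedContinuousFunction (ι → ℝ≥0) ℝ) :=
  { Algebra.adjoin ℝ (orthantExpSubmonoid ι : Set (BoundedContinuousFunction (ι → ℝ≥0) ℝ)) with
    star_mem' := by
      intro g hg
      have : star g = g := by ext x; simp
      rwa [this] }

lemma mem_orthantExpAlgebra_iff {g : BoundedContinuousFunction (ι → ℝ≥0) ℝ} :
    g ∈ orthantExpAlgebra ι ↔ g ∈ Submodule.span ℝ (Set.range (orthantExp (ι := ι))) := by
  have h := Algebra.adjoin_eq_span ℝ
    (orthantExpSubmonoid ι : Set (BoundedContinuousFunction (ι → ℝ≥0) ℝ))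
  rw [Submonoid.closure_eq] at h
  change g ∈ Subalgebra.toSubmodule (Algebra.adjoin ℝ
    (orthantExpSubmonoid ι : Set (BoundedContinuousFunction (ι → ℝ≥0) ℝ))) ↔ _
  rw [h]
  rfl

/-- A finite measure on the positive orthant is determined by its Laplace transform. -/
theorem ext_of_laplace_orthant {P P' : Measure (ι → ℝ≥0)} [IsFiniteMeasure P] [IsFiniteMeasure P']
    (h : ∀ s : ι → ℝ≥0, ∫⁻ x, negExp (∑ i, s i * x i) ∂P = ∫⁻ x, negExp (∑ i, s i * x i) ∂P') :
    P = P' := by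
  have key : ∀ (μ : Measure (ι → ℝ≥0)) (s : ι → ℝ≥0), ∫ x, orthantExp s x ∂μ =
      (∫⁻ x, negExp (∑ i, s i * x i) ∂μ).toReal := by
    intro μ s
    rw [integral_eq_lintegral_of_nonneg_ae]
    · congr 1
      refine lintegral_congr fun x => ?_
      have : (∑ i, (s i : ℝ≥0∞) * x i) = ((∑ i, s i * x i : ℝ≥0) : ℝ≥0∞) := by push_cast; rfl
      rw [this, negExp_coe, orthantExp_apply]
      push_cast
      rfl
    · exact ae_of_all _ fun x => by rw [orthantExp_apply]; positivity
    · exact (orthantExp s).continuous.measurable.aestronglyMeasurable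
  refine ext_of_forall_mem_subalgebra_integral_eq_of_polish (𝕜 := ℝ) (A := orthantExpAlgebra ι)
    ?_ ?_
  -- Points that differ in coordinate `i` are separated by `e^{-x_i}`; the rest is the determination
  -- of finite measures by a point-separating algebra.
  · intro x y hxy
    obtain ⟨i, hi⟩ := Function.ne_iff.1 hxy
    classical
    have hmem : orthantExp (Pi.single i 1) ∈ orthantExpAlgebra ι :=
      mem_orthantExpAlgebra_iff.2 (Submodule.subset_span ⟨_, rfl⟩)
    refine ⟨orthantExp (Pi.single i 1), ⟨_, ⟨_, hmem, rfl⟩, rfl⟩, ?_⟩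
    have hsum : ∀ z : ι → ℝ≥0, ∑ j, ((Pi.single i 1 : ι → ℝ≥0) j : ℝ) * z j = z i := by
      intro z
      rw [Finset.sum_eq_single i] <;> simp +contextual
    simp only [orthantExp_apply, hsum]
    simpa using hi
  · intro g hg
    rw [mem_orthantExpAlgebra_iff] at hg
    induction hg using Submodule.span_induction with
    | mem g hg =>
      obtain ⟨s, rfl⟩ := hg
      rw [key, key, h]
    | zero => simp
    | add f g _ _ hf hg =>
      simp only [BoundedContinuousFunction.coe_add, Pi.add_apply]
      rw [integral_add (f.integrable _) (g.integrable _),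
        integral_add (f.integrable _) (g.integrable _), hf, hg]
    | smul a f _ hf =>
      simp only [BoundedContinuousFunction.coe_smul]
      rw [integral_smul, integral_smul, hf]

end LaplaceUniqueness

/-! ### Laplace functionals and local finiteness of random measures. -/

/-- As `s ↓ 0`, `e^{-sX}` tends to the indicator of `X < ∞`. This reads the probability of
finiteness off a Laplace transform. -/
lemma tendsto_lintegral_negExp_div {α : Type*} [MeasurableSpace α] (Q : Measure α)
    [IsFiniteMeasure Q] {X : α → ℝ≥0∞} (hX : Measurable X) :
    Tendsto (fun n : ℕ => ∫⁻ a, negExp (((n : ℝ≥0∞) + 1)⁻¹ * X a) ∂Q) atTop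
      (𝓝 (Q {a | X a < ∞})) := by
  have hS : MeasurableSet {a | X a < ∞} := measurableSet_lt hX measurable_const
  rw [← lintegral_indicator_one hS]
  refine tendsto_lintegral_of_dominated_convergence (fun _ => 1) (fun n => by fun_prop)
    (fun n => ae_of_all _ fun a => negExp_le_one _) (by simp) (ae_of_all _ fun a => ?_)
  by_cases ha : X a < ∞
  · rw [Set.indicator_of_mem (by exact ha)]
    have h1 : Tendsto (fun n : ℕ => ((n : ℝ≥0∞) + 1)⁻¹) atTop (𝓝 0) := by
      have := (tendsto_add_atTop_iff_nat 1).2 ENNReal.tendsto_inv_nat_nhds_zero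
      simpa using this
    have h2 : Tendsto (fun n : ℕ => ((n : ℝ≥0∞) + 1)⁻¹ * X a) atTop (𝓝 0) := by
      simpa using ENNReal.Tendsto.mul_const h1 (Or.inr ha.ne)
    simpa [Function.comp_def] using (continuous_negExp.tendsto 0).comp h2
  · rw [Set.indicator_of_notMem (by exact ha)]
    have : X a = ∞ := by simpa using ha
    simp only [this]
    have h : ∀ n : ℕ, ((n : ℝ≥0∞) + 1)⁻¹ * ∞ = ∞ := fun n =>
      ENNReal.mul_top (by simp)
    simp [h]

section RandomMeasures

variable {Θ : Type*} [MetricSpace Θ] [MeasurableSpace Θ]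

/-- The annulus `{x | k ≤ d(x₀, x) < k + 1}`. -/
def annulus {Θ : Type*} [MetricSpace Θ] (x₀ : Θ) (k : ℕ) : Set Θ := {x | ⌊dist x x₀⌋₊ = k}

lemma measurableSet_annulus [BorelSpace Θ] (x₀ : Θ) (k : ℕ) : MeasurableSet (annulus x₀ k) := by
  have : Measurable fun x : Θ => ⌊dist x x₀⌋₊ :=
    Nat.measurable_floor.comp (continuous_id.dist continuous_const).measurable
  exact this (measurableSet_singleton k)

lemma isBounded_annulus {Θ : Type*} [MetricSpace Θ] (x₀ : Θ) (k : ℕ) :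
    Bornology.IsBounded (annulus x₀ k) := by
  refine (Metric.isBounded_ball (x := x₀) (r := k + 1)).subset fun x hx => ?_
  rw [Metric.mem_ball]
  have := Nat.lt_floor_add_one (dist x x₀)
  rwa [show ⌊dist x x₀⌋₊ = k from hx] at this

lemma pairwise_disjoint_annulus {Θ : Type*} [MetricSpace Θ] (x₀ : Θ) :
    Pairwise (Function.onFun Disjoint (annulus x₀)) := by
  intro i j hij
  refine Set.disjoint_left.2 fun x hi hj => hij ?_
  rw [← show ⌊dist x x₀⌋₊ = i from hi, show ⌊dist x x₀⌋₊ = j from hj]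

lemma iUnion_annulus {Θ : Type*} [MetricSpace Θ] (x₀ : Θ) : ⋃ k, annulus x₀ k = Set.univ :=
  Set.eq_univ_of_forall fun _ => Set.mem_iUnion.2 ⟨_, rfl⟩

lemma measure_eq_tsum_annulus [BorelSpace Θ] (x₀ : Θ) (m : Measure Θ) {A : Set Θ}
    (hA : MeasurableSet A) : m A = ∑' k, m (A ∩ annulus x₀ k) := by
  rw [← measure_iUnion, ← Set.inter_iUnion, iUnion_annulus, Set.inter_univ]
  · exact fun i j hij => ((pairwise_disjoint_annulus x₀) hij).mono Set.inter_subset_right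
      Set.inter_subset_right
  · exact fun k => hA.inter (measurableSet_annulus x₀ k)

/-- A bounded set meets only finitely many annuli. Local finiteness thus becomes a countable
condition, suited to almost sure statements. -/
lemma FiniteOnBounded.of_annulus (x₀ : Θ) {m : Measure Θ} (h : ∀ k, m (annulus x₀ k) < ∞) :
    FiniteOnBounded m := by
  intro s hs
  obtain ⟨r, hr⟩ := hs.subset_ball x₀
  have hsub : s ⊆ ⋃ k ∈ Finset.range (⌊r⌋₊ + 1), annulus x₀ k := by
    intro x hx
    have hx' : dist x x₀ < r := hr hx
    simp only [Finset.mem_range, Set.mem_iUnion, exists_prop]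
    exact ⟨_, Nat.lt_succ_of_le (Nat.floor_mono hx'.le), rfl⟩
  refine (measure_mono hsub).trans_lt ((measure_biUnion_finset_le _ _).trans_lt ?_)
  exact ENNReal.sum_lt_top.2 fun k _ => h k

lemma FiniteOnBounded.smul {m : Measure Θ} (h : FiniteOnBounded m) (b : ℝ≥0) :
    FiniteOnBounded (b • m) := fun s hs => by
  rw [Measure.smul_apply, ENNReal.smul_def, smul_eq_mul]
  exact ENNReal.mul_lt_top ENNReal.coe_lt_top (h s hs)

lemma FiniteOnBounded.zero : FiniteOnBounded (0 : Measure Θ) := fun s _ => by simp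

lemma mem_BMPlus_indicator {A : Set Θ} (hA : MeasurableSet A) (hb : Bornology.IsBounded A)
    (s : ℝ≥0) : A.indicator (fun _ => (s : ℝ)) ∈ BMPlus Θ := by
  refine ⟨measurable_const.indicator hA, fun x => ?_, ⟨s, fun x => ?_⟩, ?_⟩
  · exact Set.indicator_nonneg (fun _ _ => s.2) x
  · exact Set.indicator_le_self' (fun _ _ => s.2) x |>.trans le_rfl
  · exact hb.subset Set.support_indicator_subset

lemma mem_BMPlus_sum {ι : Type*} (t : Finset ι) {f : ι → Θ → ℝ} (hf : ∀ i ∈ t, f i ∈ BMPlus Θ) :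
    (fun x => ∑ i ∈ t, f i x) ∈ BMPlus Θ := by
  classical
  induction t using Finset.induction_on with
  | empty => exact ⟨by simp, by simp, ⟨0, by simp⟩, by simp⟩
  | insert i t hi ih =>
    obtain ⟨h1, h2, ⟨C, h3⟩, h4⟩ := ih fun j hj => hf j (Finset.mem_insert_of_mem hj)
    obtain ⟨g1, g2, ⟨D, g3⟩, g4⟩ := hf i (Finset.mem_insert_self i t)
    simp_rw [Finset.sum_insert hi]
    exact ⟨g1.add h1, fun x => add_nonneg (g2 x) (h2 x), ⟨D + C, fun x => add_le_add (g3 x) (h3 x)⟩,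
      (g4.union h4).subset (Function.support_add _ _)⟩

/-- The Laplace functional of a law on measures, at `f`. -/
def laplaceFunctional {Θ : Type*} [MeasurableSpace Θ] (Q : Measure (Measure Θ)) (f : Θ → ℝ) :
    ℝ≥0∞ :=
  ∫⁻ m, negExp (∫⁻ x, ENNReal.ofReal (f x) ∂m) ∂Q

lemma lintegral_ofReal_sum_indicator {Θ : Type*} [MeasurableSpace Θ] {ι : Type*} [Fintype ι]
    {A : ι → Set Θ} (hA : ∀ i, MeasurableSet (A i)) (s : ι → ℝ≥0) (m : Measure Θ) :
    ∫⁻ x, ENNReal.ofReal (∑ i, (A i).indicator (fun _ => (s i : ℝ)) x) ∂m =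
      ∑ i, (s i : ℝ≥0∞) * m (A i) := by
  have : ∀ x, ENNReal.ofReal (∑ i, (A i).indicator (fun _ => (s i : ℝ)) x) =
      ∑ i, (A i).indicator (fun _ => (s i : ℝ≥0∞)) x := by
    intro x
    have h0 : ∀ i ∈ Finset.univ, 0 ≤ (A i).indicator (fun _ => (s i : ℝ)) x :=
      fun i _ => Set.indicator_nonneg (fun _ _ => NNReal.coe_nonneg _) x
    rw [ENNReal.ofReal_sum_of_nonneg h0]
    refine Finset.sum_congr rfl fun i _ => ?_
    by_cases hx : x ∈ A i <;> simp [hx]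
  simp_rw [this]
  rw [lintegral_finsetSum _ (fun i _ => measurable_const.indicator (hA i))]
  simp_rw [lintegral_indicator_const (hA _)]

lemma laplaceFunctional_sum_indicator {Θ : Type*} [MeasurableSpace Θ] (Q : Measure (Measure Θ))
    {ι : Type*} [Fintype ι] {A : ι → Set Θ} (hA : ∀ i, MeasurableSet (A i)) (s : ι → ℝ≥0) :
    laplaceFunctional Q (fun x => ∑ i, (A i).indicator (fun _ => (s i : ℝ)) x) =
      ∫⁻ m, negExp (∑ i, (s i : ℝ≥0∞) * m (A i)) ∂Q := by
  simp_rw [laplaceFunctional, lintegral_ofReal_sum_indicator hA]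

lemma laplaceFunctional_indicator {Θ : Type*} [MeasurableSpace Θ] (Q : Measure (Measure Θ))
    {A : Set Θ} (hA : MeasurableSet A) (s : ℝ≥0) :
    laplaceFunctional Q (A.indicator (fun _ => (s : ℝ))) =
      ∫⁻ m, negExp ((s : ℝ≥0∞) * m A) ∂Q := by
  simpa using laplaceFunctional_sum_indicator Q (ι := Unit) (A := fun _ => A) (fun _ => hA)
    (fun _ => s)

/-- The weight `1 / (n + 1)`. -/
def invSucc (n : ℕ) : ℝ≥0 := ((n : ℝ≥0) + 1)⁻¹

lemma coe_invSucc (n : ℕ) : (invSucc n : ℝ≥0∞) = ((n : ℝ≥0∞) + 1)⁻¹ := by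
  rw [invSucc, ENNReal.coe_inv (by positivity)]
  simp

lemma tendsto_laplaceFunctional_indicator {Θ : Type*} [MeasurableSpace Θ] (Q : Measure (Measure Θ))
    [IsFiniteMeasure Q] {A : Set Θ} (hA : MeasurableSet A) :
    Tendsto (fun n => laplaceFunctional Q (A.indicator (fun _ => (invSucc n : ℝ)))) atTop
      (𝓝 (Q {m | m A < ∞})) := by
  simp_rw [laplaceFunctional_indicator Q hA, coe_invSucc]
  exact tendsto_lintegral_negExp_div Q (Measure.measurable_coe hA)

lemma ae_finiteOnBounded_of_tendsto [BorelSpace Θ] [Nonempty Θ] (Q : Measure (Measure Θ))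
    [IsFiniteMeasure Q]
    (h : ∀ A : Set Θ, MeasurableSet A → Bornology.IsBounded A →
      Tendsto (fun n => laplaceFunctional Q (A.indicator (fun _ => (invSucc n : ℝ)))) atTop
        (𝓝 (Q Set.univ))) :
    ∀ᵐ m ∂Q, FiniteOnBounded m := by
  obtain ⟨x₀⟩ := ‹Nonempty Θ›
  have h' : ∀ k, ∀ᵐ m ∂Q, m (annulus x₀ k) < ∞ := by
    intro k
    have hA := measurableSet_annulus x₀ k
    have h1 := tendsto_nhds_unique (tendsto_laplaceFunctional_indicator Q hA)
      (h _ hA (isBounded_annulus x₀ k))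
    exact (ae_iff_measure_eq (measurableSet_lt (Measure.measurable_coe hA)
      measurable_const).nullMeasurableSet).2 h1
  filter_upwards [ae_all_iff.2 h'] with m hm
  exact FiniteOnBounded.of_annulus x₀ hm

/-- The mass of `{m A < ∞}` is a limit of Laplace functionals at small multiples of the indicator of
`A`, so local finiteness passes to any law with the same functional. -/
lemma ae_finiteOnBounded_of_laplaceFunctional_eq [BorelSpace Θ] [Nonempty Θ]
    {Q₁ Q₂ : Measure (Measure Θ)} [IsFiniteMeasure Q₁] [IsFiniteMeasure Q₂]
    (h : ∀ f ∈ BMPlus Θ, laplaceFunctional Q₁ f = laplaceFunctional Q₂ f)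
    (h₁ : ∀ᵐ m ∂Q₁, FiniteOnBounded m) : ∀ᵐ m ∂Q₂, FiniteOnBounded m := by
  have huniv : Q₁ Set.univ = Q₂ Set.univ := by
    have := h _ (mem_BMPlus_indicator MeasurableSet.empty Bornology.isBounded_empty 0)
    simpa [laplaceFunctional] using this
  refine ae_finiteOnBounded_of_tendsto Q₂ fun A hA hb => ?_
  simp_rw [← fun n => h _ (mem_BMPlus_indicator hA hb (invSucc n))]
  rw [← huniv]
  have : Q₁ {m | m A < ∞} = Q₁ Set.univ := by
    refine (ae_iff_measure_eq (measurableSet_lt (Measure.measurable_coe hA)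
      measurable_const).nullMeasurableSet).1 ?_
    filter_upwards [h₁] with m hm using hm A hb
  rw [← this]
  exact tendsto_laplaceFunctional_indicator Q₁ hA

/-- The bounded measurable sets. -/
abbrev BoundedMeasurableSet (Θ : Type*) [MetricSpace Θ] [MeasurableSpace Θ] : Type _ :=
  {A : Set Θ // MeasurableSet A ∧ Bornology.IsBounded A}

lemma measurable_tsum_ennreal {α : Type*} (mα : MeasurableSpace α) {F : ℕ → α → ℝ≥0∞}
    (hF : ∀ k, Measurable (F k)) : Measurable fun a => ∑' k, F k a :=
  Measurable.tsum hF

/-- The mass of any measurable set is the sum of its masses on the annuli. A generating π-system can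
therefore be built from bounded sets alone, where masses are almost surely finite. -/
lemma measurableSpace_measure_eq_iSup [BorelSpace Θ] [Nonempty Θ] :
    (Measure.instMeasurableSpace : MeasurableSpace (Measure Θ)) =
      ⨆ A : BoundedMeasurableSet Θ,
        MeasurableSpace.comap (fun m : Measure Θ => m A.1) inferInstance := by
  obtain ⟨x₀⟩ := ‹Nonempty Θ›
  apply le_antisymm
  · refine iSup₂_le fun A hA => ?_
    rw [← measurable_iff_comap_le]
    simp_rw [measure_eq_tsum_annulus x₀ _ hA]
    refine measurable_tsum_ennreal _ fun k => ?_
    have hb : MeasurableSet (A ∩ annulus x₀ k) ∧ Bornology.IsBounded (A ∩ annulus x₀ k) :=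
      ⟨hA.inter (measurableSet_annulus x₀ k),
        (isBounded_annulus x₀ k).subset Set.inter_subset_right⟩
    rw [measurable_iff_comap_le]
    exact le_iSup (fun A : BoundedMeasurableSet Θ =>
      MeasurableSpace.comap (fun m : Measure Θ => m A.1) inferInstance) ⟨_, hb⟩
  · exact iSup_le fun A => measurable_iff_comap_le.1 (Measure.measurable_coe A.2.1)

/-- The Laplace functional determines a finite measure on the space of measures that are finite
on bounded sets. -/
theorem ext_of_laplaceFunctional [BorelSpace Θ] [Nonempty Θ]
    {Q₁ Q₂ : Measure (Measure Θ)} [IsFiniteMeasure Q₁] [IsFiniteMeasure Q₂]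
    (h : ∀ f ∈ BMPlus Θ, laplaceFunctional Q₁ f = laplaceFunctional Q₂ f)
    (h₁ : ∀ᵐ m ∂Q₁, FiniteOnBounded m) : Q₁ = Q₂ := by
  have h₂ := ae_finiteOnBounded_of_laplaceFunctional_eq h h₁
  have huniv : Q₁ Set.univ = Q₂ Set.univ := by
    have := h _ (mem_BMPlus_indicator MeasurableSet.empty Bornology.isBounded_empty 0)
    simpa [laplaceFunctional] using this
  let ms : BoundedMeasurableSet Θ → MeasurableSpace (Measure Θ) := fun A =>
    MeasurableSpace.comap (fun m : Measure Θ => m A.1) inferInstance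
  have hgen : (Measure.instMeasurableSpace : MeasurableSpace (Measure Θ)) =
      MeasurableSpace.generateFrom
        (piiUnionInter (fun A => {s | MeasurableSet[ms A] s}) Set.univ) := by
    rw [generateFrom_piiUnionInter_measurableSet ms, measurableSpace_measure_eq_iSup]
    simp [ms]
  refine ext_of_generate_finite _ hgen
    (isPiSystem_piiUnionInter _ (fun A => (ms A).isPiSystem_measurableSet) _) ?_ huniv
  rintro _ ⟨t, -, f, hf, rfl⟩
  have hC : ∀ A : t, ∃ C : Set ℝ≥0∞, MeasurableSet C ∧ (fun m : Measure Θ => m A.1.1) ⁻¹' C = f A :=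
    fun A => hf A A.2
  choose C hCm hC using hC
  -- The vector of masses of finitely many bounded sets. Its Laplace transform is the Laplace
  -- functional at a combination of indicators, so the orthant theorem gives its law. Truncating `∞`
  -- to `0` matters only on a null set.
  let T : Measure Θ → t → ℝ≥0 := fun m A => (m A.1.1).toNNReal
  have hT : Measurable T := measurable_pi_lambda _ fun A =>
    (Measure.measurable_coe A.1.2.1).ennreal_toNNReal
  have hmap : Q₁.map T = Q₂.map T := by
    refine ext_of_laplace_orthant fun s => ?_
    rw [lintegral_map (by fun_prop) hT, lintegral_map (by fun_prop) hT]
    have key : ∀ Q : Measure (Measure Θ), (∀ᵐ m ∂Q, FiniteOnBounded m) →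
        ∫⁻ m, negExp (∑ i, (s i : ℝ≥0∞) * (T m i : ℝ≥0)) ∂Q =
          laplaceFunctional Q
            (fun x => ∑ i : t, (i.1.1).indicator (fun _ => (s i : ℝ)) x) := by
      intro Q hQ
      rw [laplaceFunctional_sum_indicator Q (A := fun i : t => i.1.1) (fun i => i.1.2.1)]
      refine lintegral_congr_ae ?_
      filter_upwards [hQ] with m hm
      congr 1
      refine Finset.sum_congr rfl fun i _ => ?_
      rw [ENNReal.coe_toNNReal (hm _ i.1.2.2).ne]
    rw [key Q₁ h₁, key Q₂ h₂]
    exact h _ (mem_BMPlus_sum _ fun i _ => mem_BMPlus_indicator i.1.2.1 i.1.2.2 _)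
  have hD : MeasurableSet {y : t → ℝ≥0 | ∀ i, (y i : ℝ≥0∞) ∈ C i} := by
    rw [Set.ofPred_forall]
    exact MeasurableSet.iInter fun i => (measurable_coe_nnreal_ennreal.comp
      (measurable_pi_apply i)) (hCm i)
  have key : ∀ Q : Measure (Measure Θ), (∀ᵐ m ∂Q, FiniteOnBounded m) →
      Q (⋂ x ∈ t, f x) = Q.map T {y : t → ℝ≥0 | ∀ i, (y i : ℝ≥0∞) ∈ C i} := by
    intro Q hQ
    rw [Measure.map_apply hT hD]
    refine measure_congr ?_
    filter_upwards [hQ] with m hm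
    apply propext
    change m ∈ (⋂ x ∈ t, f x) ↔ ∀ i : t, (T m i : ℝ≥0∞) ∈ C i
    simp only [Set.mem_iInter]
    constructor
    · intro hx i
      have := hx i.1 i.2
      rw [← hC i] at this
      rw [ENNReal.coe_toNNReal (hm _ i.1.2.2).ne]
      exact this
    · intro hx i hi
      have := hx ⟨i, hi⟩
      rw [ENNReal.coe_toNNReal (hm _ i.2.2).ne] at this
      rw [← hC ⟨i, hi⟩]
      exact this
  rw [key Q₁ h₁, key Q₂ h₂, hmap]

end RandomMeasures

/-! ### Gamma laws on measures through Laplace functionals with values in `[0, ∞]`. -/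

section LaplaceOfLaws

variable {Θ : Type*} [MetricSpace Θ] [MeasurableSpace Θ]

lemma BMPlus.of_le {f g : Θ → ℝ} (hf : f ∈ BMPlus Θ) (hg : Measurable g) (h0 : ∀ x, 0 ≤ g x)
    {c : ℝ≥0} (hle : ∀ x, g x ≤ c * f x) : g ∈ BMPlus Θ := by
  obtain ⟨h1, h2, ⟨C, h3⟩, h4⟩ := hf
  refine ⟨hg, h0, ⟨c * C, fun x => (hle x).trans (by gcongr; exact h3 x)⟩, h4.subset fun x hx => ?_⟩
  intro hfx
  refine hx (le_antisymm ?_ (h0 x))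
  simpa [hfx] using hle x

lemma lintegral_ofReal_ne_top_of_mem_BMPlus {f : Θ → ℝ} (hf : f ∈ BMPlus Θ) {m : Measure Θ}
    (hm : FiniteOnBounded m) : ∫⁻ x, ENNReal.ofReal (f x) ∂m ≠ ∞ := by
  obtain ⟨h1, h2, ⟨C, h3⟩, h4⟩ := hf
  have hS : MeasurableSet (Function.support f) := measurableSet_support h1
  have hle : ∀ x, ENNReal.ofReal (f x) ≤
      (Function.support f).indicator (fun _ => ENNReal.ofReal C) x := by
    intro x
    by_cases hx : x ∈ Function.support f
    · rw [Set.indicator_of_mem hx]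
      exact ENNReal.ofReal_le_ofReal (h3 x)
    · simp [Function.notMem_support.1 hx]
  refine ((lintegral_mono hle).trans_lt ?_).ne
  rw [lintegral_indicator_const hS]
  exact ENNReal.mul_lt_top ENNReal.ofReal_lt_top (hm _ h4)

lemma ofReal_integral_of_mem_BMPlus {f : Θ → ℝ} (hf : f ∈ BMPlus Θ) {m : Measure Θ}
    (hm : FiniteOnBounded m) :
    ENNReal.ofReal (∫ x, f x ∂m) = ∫⁻ x, ENNReal.ofReal (f x) ∂m := by
  have hi := lintegral_ofReal_ne_top_of_mem_BMPlus hf hm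
  rw [integral_eq_lintegral_of_nonneg_ae (ae_of_all _ hf.2.1) hf.1.aestronglyMeasurable,
    ENNReal.ofReal_toReal hi]

lemma measurable_lintegral_ofReal {f : Θ → ℝ} (hf : f ∈ BMPlus Θ) :
    Measurable fun m : Measure Θ => ∫⁻ x, ENNReal.ofReal (f x) ∂m :=
  Measure.measurable_lintegral hf.1.ennreal_ofReal

lemma laplaceFunctional_ne_top {Θ : Type*} [MeasurableSpace Θ] (Q : Measure (Measure Θ))
    [IsFiniteMeasure Q] (f : Θ → ℝ) :
    laplaceFunctional Q f ≠ ∞ :=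
  ((lintegral_negExp_le_measure_univ Q _).trans_lt (measure_lt_top _ _)).ne

lemma integral_exp_neg_eq_toReal_laplaceFunctional {Q : Measure (Measure Θ)} {f : Θ → ℝ}
    (hf : f ∈ BMPlus Θ) (hQ : ∀ᵐ m ∂Q, FiniteOnBounded m) :
    ∫ m, Real.exp (-∫ x, f x ∂m) ∂Q = (laplaceFunctional Q f).toReal := by
  have h : ∀ᵐ m ∂Q, Real.exp (-∫ x, f x ∂m) =
      (negExp (∫⁻ x, ENNReal.ofReal (f x) ∂m)).toReal := by
    filter_upwards [hQ] with m hm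
    rw [← ofReal_integral_of_mem_BMPlus hf hm, negExp_ofReal (integral_nonneg hf.2.1),
      ENNReal.toReal_ofReal (Real.exp_pos _).le]
  rw [integral_congr_ae h, laplaceFunctional, integral_toReal]
  · exact (measurable_negExp.comp (measurable_lintegral_ofReal hf)).aemeasurable
  · exact ae_of_all _ fun m => (negExp_ne_top _).lt_top

/-- The Laplace exponent of the noncentral gamma law `NcGaP(H, M, c⁻¹)`. -/
def ncExponent {Θ : Type*} [MeasurableSpace Θ] (H M : Measure Θ) (c : ℝ≥0) (f : Θ → ℝ) : ℝ≥0∞ :=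
  ∫⁻ x, ENNReal.ofReal (Real.log (1 + c * f x)) ∂H +
    ∫⁻ x, ENNReal.ofReal (c * f x / (1 + c * f x)) ∂M

lemma log_one_add_mem_BMPlus {f : Θ → ℝ} (hf : f ∈ BMPlus Θ) (c : ℝ≥0) :
    (fun x => Real.log (1 + c * f x)) ∈ BMPlus Θ := by
  have h1 := hf.1
  have h0 : ∀ x, 0 ≤ (c : ℝ) * f x := fun x => mul_nonneg c.2 (hf.2.1 x)
  refine BMPlus.of_le hf (by fun_prop) (fun x => Real.log_nonneg (by linarith [h0 x])) (c := c)
    fun x => ?_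
  have := Real.log_le_sub_one_of_pos (x := 1 + c * f x) (by linarith [h0 x])
  linarith

lemma div_one_add_mem_BMPlus {f : Θ → ℝ} (hf : f ∈ BMPlus Θ) (c : ℝ≥0) :
    (fun x => c * f x / (1 + c * f x)) ∈ BMPlus Θ := by
  have h1 := hf.1
  have h0 : ∀ x, 0 ≤ (c : ℝ) * f x := fun x => mul_nonneg c.2 (hf.2.1 x)
  refine BMPlus.of_le hf (by fun_prop) (fun x => div_nonneg (h0 x) (by linarith [h0 x])) (c := c)
    fun x => div_le_self (h0 x) (by linarith [h0 x])

lemma negExp_ncExponent {H M : Measure Θ} (hH : FiniteOnBounded H) (hM : FiniteOnBounded M)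
    (c : ℝ≥0) {f : Θ → ℝ} (hf : f ∈ BMPlus Θ) :
    negExp (ncExponent H M c f) = ENNReal.ofReal (Real.exp (-(∫ x, Real.log (1 + c * f x) ∂H) -
      ∫ x, c * f x / (1 + c * f x) ∂M)) := by
  have h1 := log_one_add_mem_BMPlus hf c
  have h2 := div_one_add_mem_BMPlus hf c
  rw [ncExponent, ← ofReal_integral_of_mem_BMPlus h1 hH, ← ofReal_integral_of_mem_BMPlus h2 hM,
    ← ENNReal.ofReal_add (integral_nonneg h1.2.1) (integral_nonneg h2.2.1),
    negExp_ofReal (add_nonneg (integral_nonneg h1.2.1) (integral_nonneg h2.2.1)), neg_add]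
  rfl

/-- Both integrands vanish off `A`, and both `log(1+y)` and `y/(1+y)` are at most `y`. -/
lemma ncExponent_indicator_le {Θ : Type*} [MeasurableSpace Θ] (H M : Measure Θ) (c s : ℝ≥0)
    {A : Set Θ} (hA : MeasurableSet A) :
    ncExponent H M c (A.indicator fun _ => (s : ℝ)) ≤ s * (c * (H A + M A)) := by
  have h : ∀ m : Measure Θ, ∀ g : ℝ → ℝ, g 0 ≤ 0 → g s ≤ c * s →
      ∫⁻ x, ENNReal.ofReal (g (A.indicator (fun _ => (s : ℝ)) x)) ∂m ≤ s * c * m A := by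
    intro m g g0 gs
    have hle : ∀ x, ENNReal.ofReal (g (A.indicator (fun _ => (s : ℝ)) x)) ≤
        A.indicator (fun _ => (s * c : ℝ≥0∞)) x := by
      intro x
      by_cases hx : x ∈ A
      · simp only [hx, Set.indicator_of_mem]
        refine (ENNReal.ofReal_le_ofReal gs).trans ?_
        rw [mul_comm, ← NNReal.coe_mul, ENNReal.ofReal_coe_nnreal]
        push_cast
        rfl
      · simp [hx, g0]
    exact (lintegral_mono hle).trans_eq (lintegral_indicator_const hA _)
  have hcs : 0 ≤ (c : ℝ) * s := by positivity
  have h1 := h H (fun y => Real.log (1 + c * y)) (by simp) (by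
    have := Real.log_le_sub_one_of_pos (x := 1 + c * (s : ℝ)) (by linarith)
    linarith)
  have h2 := h M (fun y => c * y / (1 + c * y)) (by simp) (div_le_self hcs (by linarith))
  refine (add_le_add h1 h2).trans_eq ?_
  ring

lemma tendsto_negExp_ncExponent_indicator {H M : Measure Θ} (hH : FiniteOnBounded H)
    (hM : FiniteOnBounded M) (c : ℝ≥0) {A : Set Θ} (hA : MeasurableSet A)
    (hb : Bornology.IsBounded A) :
    Tendsto (fun n => negExp (ncExponent H M c (A.indicator fun _ => (invSucc n : ℝ)))) atTop
      (𝓝 1) := by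
  have h0 : Tendsto (fun n => (invSucc n : ℝ≥0∞) * (c * (H A + M A))) atTop (𝓝 0) := by
    have h1 : Tendsto (fun n : ℕ => (invSucc n : ℝ≥0∞)) atTop (𝓝 0) := by
      simp_rw [coe_invSucc]
      simpa using (tendsto_add_atTop_iff_nat 1).2 ENNReal.tendsto_inv_nat_nhds_zero
    have h2 : (c : ℝ≥0∞) * (H A + M A) ≠ ∞ :=
      ENNReal.mul_ne_top ENNReal.coe_ne_top (ENNReal.add_ne_top.2 ⟨(hH A hb).ne, (hM A hb).ne⟩)
    simpa using ENNReal.Tendsto.mul_const h1 (Or.inr h2)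
  have h1 := (continuous_negExp.tendsto 0).comp h0
  rw [negExp_zero] at h1
  exact tendsto_of_tendsto_of_tendsto_of_le_of_le h1 tendsto_const_nhds
    (fun n => negExp_antitone (ncExponent_indicator_le H M c _ hA)) (fun n => negExp_le_one _)

/-- Noncentral gamma laws are characterised by their Laplace functional on `[0, ∞]`. -/
theorem isNcGammaProcessLaw_iff [BorelSpace Θ] [Nonempty Θ] {H M : Measure Θ}
    (hH : FiniteOnBounded H) (hM : FiniteOnBounded M) (c : ℝ≥0) (Q : Measure (Measure Θ))
    [IsProbabilityMeasure Q] :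
    IsNcGammaProcessLaw H M ((c : ℝ)⁻¹) Q ↔
      ∀ f ∈ BMPlus Θ, laplaceFunctional Q f = negExp (ncExponent H M c f) := by
  constructor
  · intro h f hf
    have h1 := h.laplace f hf
    rw [inv_inv, integral_exp_neg_eq_toReal_laplaceFunctional hf h.finiteOnBounded] at h1
    rw [negExp_ncExponent hH hM c hf, ← h1, ENNReal.ofReal_toReal (laplaceFunctional_ne_top Q f)]
  · intro h
    -- Local finiteness is not assumed in this direction: the exponent tends to `0` along small
    -- multiples of an indicator, which forces finite mass almost surely.
    have hLF : ∀ᵐ m ∂Q, FiniteOnBounded m := by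
      refine ae_finiteOnBounded_of_tendsto Q fun A hA hb => ?_
      simp_rw [fun n => h _ (mem_BMPlus_indicator hA hb (invSucc n)), measure_univ]
      exact tendsto_negExp_ncExponent_indicator hH hM c hA hb
    refine ⟨inferInstance, hLF, fun f hf => ?_⟩
    rw [inv_inv, integral_exp_neg_eq_toReal_laplaceFunctional hf hLF, h f hf,
      negExp_ncExponent hH hM c hf, ENNReal.toReal_ofReal (Real.exp_pos _).le]

lemma isGammaProcessLaw_iff_isNcGammaProcessLaw_zero {H : Measure Θ} {r : ℝ}
    {Q : Measure (Measure Θ)} : IsGammaProcessLaw H r Q ↔ IsNcGammaProcessLaw H 0 r Q := by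
  constructor
  · rintro ⟨h1, h2, h3⟩
    refine ⟨h1, h2, fun f hf => ?_⟩
    rw [h3 f hf]
    simp [div_eq_inv_mul]
  · rintro ⟨h1, h2, h3⟩
    refine ⟨h1, h2, fun f hf => ?_⟩
    rw [h3 f hf]
    simp [div_eq_inv_mul]

end LaplaceOfLaws

/-! ### Poisson, gamma and noncentral gamma-zero laws. -/

/-- The probability generating function of the Poisson law, used both for the scalar laws and for
compound Poisson sums. -/
lemma tsum_poissonMeasure_mul_pow (b q : ℝ≥0) (hq : q ≤ 1) :
    ∑' n : ℕ, poissonMeasure b {n} * (q : ℝ≥0∞) ^ n = negExp ((b * (1 - q) : ℝ≥0) : ℝ≥0∞) := by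
  have h1 : ∀ n : ℕ, poissonMeasure b {n} * (q : ℝ≥0∞) ^ n =
      ENNReal.ofReal (Real.exp (-b) * ((b * q : ℝ) ^ n / n.factorial)) := by
    intro n
    rw [poissonMeasure_singleton, ← ENNReal.ofReal_coe_nnreal,
      ← ENNReal.ofReal_pow (NNReal.coe_nonneg q),
      ← ENNReal.ofReal_mul (by positivity), mul_pow]
    congr 1
    ring
  have hs : HasSum (fun n : ℕ => Real.exp (-b) * ((b * q : ℝ) ^ n / n.factorial))
      (Real.exp (-b) * Real.exp (b * q)) := by
    have := (NormedSpace.expSeries_div_hasSum_exp (b * q : ℝ)).mul_left (Real.exp (-b))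
    rwa [← Real.exp_eq_exp_ℝ] at this
  simp_rw [h1]
  rw [← ENNReal.ofReal_tsum_of_nonneg (fun n => by positivity) hs.summable, hs.tsum_eq, negExp_coe,
    ← Real.exp_add]
  congr 2
  rw [NNReal.coe_mul, NNReal.coe_sub hq]
  push_cast
  ring

lemma tsum_poissonMeasure_singleton (b : ℝ≥0) : ∑' n : ℕ, poissonMeasure b {n} = 1 := by
  simpa using tsum_poissonMeasure_mul_pow b 1 le_rfl

/-- Exponential tilting: `e^{-sy}` times the gamma density of rate `r` is a constant times the gamma
density of rate `r + s`, which has total mass one. -/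
lemma lintegral_negExp_gammaMeasure {a r : ℝ} (ha : 0 < a) (hr : 0 < r) (s : ℝ≥0) :
    ∫⁻ y, negExp (ENNReal.ofReal y * s) ∂(gammaMeasure a r) =
      ENNReal.ofReal ((r / (r + s)) ^ a) := by
  have hrs : 0 < r + s := by positivity
  have hpdf : ∀ r, Measurable (gammaPDF a r) := fun r =>
    (measurable_gammaPDFReal a r).ennreal_ofReal
  rw [gammaMeasure, lintegral_withDensity_eq_lintegral_mul _ (hpdf r) (by fun_prop)]
  have h : ∀ y, (gammaPDF a r * fun y => negExp (ENNReal.ofReal y * s)) y =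
      ENNReal.ofReal ((r / (r + s)) ^ a) * gammaPDF a (r + s) y := by
    intro y
    rw [Pi.mul_apply]
    rcases lt_or_ge y 0 with hy | hy
    · simp [gammaPDF_of_neg hy]
    · rw [gammaPDF_of_nonneg hy, gammaPDF_of_nonneg hy, ← ENNReal.ofReal_coe_nnreal (p := s),
        ← ENNReal.ofReal_mul hy, negExp_ofReal (by positivity), ← ENNReal.ofReal_mul
        (by positivity), ← ENNReal.ofReal_mul (by positivity), Real.div_rpow hr.le hrs.le]
      congr 1
      have : Real.exp (-((r + s) * y)) = Real.exp (-(r * y)) * Real.exp (-(y * s)) := by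
        rw [← Real.exp_add]; ring_nf
      rw [this]
      have h3 : (r + s) ^ a ≠ 0 := (Real.rpow_pos_of_pos hrs a).ne'
      field_simp
  simp_rw [h]
  rw [lintegral_const_mul _ (hpdf _), lintegral_gammaPDF_eq_one ha hrs, mul_one]

lemma gammaMeasure_Iio_zero (a r : ℝ) : gammaMeasure a r (Set.Iio 0) = 0 := by
  rw [gammaMeasure, withDensity_apply _ measurableSet_Iio]
  exact lintegral_gammaPDF_of_nonpos le_rfl

lemma isProbabilityMeasure_gammaLaw_nat (n : ℕ) {r : ℝ} (hr : 0 < r) :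
    IsProbabilityMeasure (gammaLaw n r) := by
  rw [gammaLaw]
  split_ifs with h
  · infer_instance
  · exact isProbabilityMeasure_gammaMeasure (by positivity) hr

lemma gammaLaw_Iio_zero (a r : ℝ) : gammaLaw a r (Set.Iio 0) = 0 := by
  rw [gammaLaw]
  split_ifs with h
  · simp
  · exact gammaMeasure_Iio_zero a r

lemma lintegral_negExp_gammaLaw (n : ℕ) {r : ℝ} (hr : 0 < r) (s : ℝ≥0) :
    ∫⁻ y, negExp (ENNReal.ofReal y * s) ∂(gammaLaw n r) =
      ENNReal.ofReal (r / (r + s)) ^ n := by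
  rw [gammaLaw]
  split_ifs with h
  · have hn : n = 0 := by exact_mod_cast h
    rw [lintegral_dirac' _ (by fun_prop)]
    simp [hn]
  · rw [lintegral_negExp_gammaMeasure (by positivity) hr, Real.rpow_natCast,
      ENNReal.ofReal_pow (by positivity)]

lemma lintegral_ncGammaLaw_zero (b : ℝ≥0) (r : ℝ) (g : ℝ → ℝ≥0∞) :
    ∫⁻ y, g y ∂(ncGammaLaw 0 b r) =
      ∑' n : ℕ, poissonMeasure b {n} * ∫⁻ y, g y ∂(gammaLaw n r) := by
  rw [ncGammaLaw, lintegral_sum_measure]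
  simp_rw [lintegral_smul_measure, zero_add, smul_eq_mul]

lemma ncGammaLaw_zero_apply (b : ℝ≥0) (r : ℝ) {s : Set ℝ} (hs : MeasurableSet s) :
    ncGammaLaw 0 b r s = ∑' n : ℕ, poissonMeasure b {n} * gammaLaw n r s := by
  rw [ncGammaLaw, Measure.sum_apply _ hs]
  simp_rw [Measure.smul_apply, zero_add, smul_eq_mul]

lemma isProbabilityMeasure_ncGammaLaw_zero (b : ℝ≥0) {r : ℝ} (hr : 0 < r) :
    IsProbabilityMeasure (ncGammaLaw 0 b r) := by
  constructor
  rw [ncGammaLaw_zero_apply b r MeasurableSet.univ]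
  have : ∀ n : ℕ, gammaLaw n r Set.univ = 1 := fun n =>
    (isProbabilityMeasure_gammaLaw_nat n hr).measure_univ
  simp_rw [this, mul_one]
  exact tsum_poissonMeasure_singleton b

/-- The Laplace transform of the noncentral gamma-zero law. -/
lemma lintegral_negExp_ncGammaLaw_zero (b : ℝ≥0) {c : ℝ≥0} (hc : 0 < c) (s : ℝ≥0) :
    ∫⁻ y, negExp (ENNReal.ofReal y * s) ∂(ncGammaLaw 0 b (c : ℝ)⁻¹) =
      negExp (b * ENNReal.ofReal (c * s / (1 + c * s))) := by
  have hc' : (0 : ℝ) < c := hc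
  rw [lintegral_ncGammaLaw_zero]
  simp_rw [lintegral_negExp_gammaLaw _ (inv_pos.2 hc')]
  -- With rate `c⁻¹`, the base of the powers is `q = 1/(1+cs)`, hence `1 - q = cs/(1+cs)`.
  have hq1 : ((c : ℝ)⁻¹ / ((c : ℝ)⁻¹ + s)).toNNReal ≤ 1 := by
    rw [Real.toNNReal_le_one]
    exact div_le_one_of_le₀ (by linarith [s.2, NNReal.coe_nonneg s]) (by positivity)
  have := tsum_poissonMeasure_mul_pow b _ hq1
  rw [ENNReal.ofReal]
  rw [this, ← ENNReal.ofReal_coe_nnreal (p := b), ← ENNReal.ofReal_mul (NNReal.coe_nonneg b),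
    ENNReal.ofReal]
  congr 2
  apply NNReal.coe_injective
  rw [NNReal.coe_mul, NNReal.coe_sub hq1, Real.coe_toNNReal _ (by positivity),
    Real.coe_toNNReal _ (by positivity)]
  have : (1 : ℝ) + c * s ≠ 0 := by positivity
  push_cast
  field_simp
  ring

lemma ncGammaLaw_zero_Iio_zero (b : ℝ≥0) (r : ℝ) : ncGammaLaw 0 b r (Set.Iio 0) = 0 := by
  rw [ncGammaLaw_zero_apply b r measurableSet_Iio]
  simp [gammaLaw_Iio_zero]

/-- Gamma laws of positive shape have densities, so only the Poisson value `0` contributes an atom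
at zero. -/
lemma ncGammaLaw_zero_singleton_zero (b : ℝ≥0) (r : ℝ) :
    ncGammaLaw 0 b r {0} = ENNReal.ofReal (Real.exp (-b)) := by
  rw [ncGammaLaw_zero_apply b r (measurableSet_singleton 0), tsum_eq_single 0]
  · simp [gammaLaw, poissonMeasure_singleton]
  · intro n hn
    have : gammaLaw n r {0} = 0 := by
      rw [gammaLaw, if_neg (by exact_mod_cast hn), gammaMeasure]
      exact withDensity_absolutelyContinuous _ _ (by simp)
    rw [this, mul_zero]

/-- The noncentral gamma-zero laws as a kernel on `[0, ∞)`. -/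
def ncGammaKernel (r : ℝ) : Kernel ℝ≥0 ℝ where
  toFun b := ncGammaLaw 0 b r
  measurable' := by
    refine Measure.measurable_of_measurable_coe _ fun s hs => ?_
    simp_rw [ncGammaLaw_zero_apply _ r hs, poissonMeasure_singleton]
    fun_prop

/-- Randomisation of a kernel by one uniform variable. Joint measurability in `b` is what allows
random weights to be substituted for it. -/
lemma exists_ncGammaLaw_zero_representation {r : ℝ} (hr : 0 < r) :
    ∃ h : ℝ≥0 → unitInterval → ℝ≥0, Measurable (Function.uncurry h) ∧
      ∀ b, volume.map (fun v => (h b v : ℝ)) = ncGammaLaw 0 b r := by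
  have : IsMarkovKernel (ncGammaKernel r) := ⟨fun b => isProbabilityMeasure_ncGammaLaw_zero b hr⟩
  obtain ⟨f, hf, hfm⟩ := Kernel.exists_measurable_map_eq_unitInterval (ncGammaKernel r)
  refine ⟨fun b v => (f b v).toNNReal, hf.real_toNNReal, fun b => ?_⟩
  have hfb : Measurable (f b) := hf.of_uncurry_left
  have h1 : ncGammaKernel r b = ncGammaLaw 0 b r := rfl
  rw [← h1, ← hfm b]
  refine Measure.map_congr ?_
  have h2 : ∀ᵐ y ∂(volume.map (f b)), 0 ≤ y := by
    rw [hfm b, h1, ae_iff]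
    simpa [← Set.Iio_def] using ncGammaLaw_zero_Iio_zero b r
  filter_upwards [ae_of_ae_map hfb.aemeasurable h2] with v hv
  exact Real.coe_toNNReal _ hv

/-! ### Compound Poisson sums from uniform seeds. -/

section Construction

/-- The randomness of a compound Poisson sum: one uniform variable for the number of summands and
a sequence of uniform variables for the summands. -/
abbrev Seeds : Type := unitInterval × (ℕ → unitInterval)

/-- The law of independent uniform seeds. -/
def seedsLaw : Measure Seeds :=
  (volume : Measure unitInterval).prod (Measure.infinitePi fun _ : ℕ => volume)

instance : IsProbabilityMeasure seedsLaw := by unfold seedsLaw; infer_instance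

variable {α Y : Type*} [MeasurableSpace α] [MeasurableSpace Y]

/-- The Poisson laws with the rates `rate a`. -/
def poissonKernel {rate : α → ℝ≥0} (hrate : Measurable rate) : Kernel α ℕ where
  toFun a := poissonMeasure (rate a)
  measurable' := by
    refine Measure.measurable_of_measurable_coe _ fun s hs => ?_
    simp_rw [poissonMeasure, Measure.sum_apply _ hs, Measure.smul_apply, smul_eq_mul]
    fun_prop

instance {rate : α → ℝ≥0} (hrate : Measurable rate) : IsMarkovKernel (poissonKernel hrate) :=
  ⟨fun a => by
    change IsProbabilityMeasure (poissonMeasure (rate a))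
    infer_instance⟩

/-- The kernel `ν` divided by its total mass. -/
def normalizedKernel (ν : Kernel α Y) : Kernel α Y where
  toFun a := (ν a Set.univ)⁻¹ • ν a
  measurable' := by
    refine Measure.measurable_of_measurable_coe _ fun s hs => ?_
    simp_rw [Measure.smul_apply, smul_eq_mul]
    exact (ν.measurable_coe MeasurableSet.univ).inv.mul (ν.measurable_coe hs)

lemma measurableSet_mass_ne (ν : Kernel α Y) :
    MeasurableSet {a | ν a Set.univ ≠ 0 ∧ ν a Set.univ ≠ ∞} :=
  ((ν.measurable_coe MeasurableSet.univ) (measurableSet_singleton 0)).compl.inter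
    ((ν.measurable_coe MeasurableSet.univ) (measurableSet_singleton ∞)).compl

/-- Normalising makes no sense at mass `0` or `∞`, where a Dirac mass keeps the kernel Markov. At
mass `0` both sides of the identity vanish. -/
lemma exists_markovKernel_smul_eq (ν : Kernel α Y) (y₀ : Y) :
    ∃ p : Kernel α Y, IsMarkovKernel p ∧ ∀ a, ν a Set.univ ≠ ∞ → ν a = ν a Set.univ • p a := by
  classical
  refine ⟨Kernel.piecewise (measurableSet_mass_ne ν) (normalizedKernel ν)
    (Kernel.const α (Measure.dirac y₀)), ⟨fun a => ?_⟩, fun a ha => ?_⟩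
  · rw [Kernel.piecewise_apply]
    split_ifs with h
    · exact ⟨ENNReal.inv_mul_cancel h.1 h.2⟩
    · rw [Kernel.const_apply]; infer_instance
  · rw [Kernel.piecewise_apply]
    split_ifs with h
    · change ν a = ν a Set.univ • ((ν a Set.univ)⁻¹ • ν a)
      rw [smul_smul, ENNReal.mul_inv_cancel h.1 h.2, one_smul]
    · have h0 : ν a Set.univ = 0 := by
        by_contra h0
        exact h ⟨h0, ha⟩
      rw [h0, zero_smul]
      exact Measure.measure_univ_eq_zero.1 h0

lemma lintegral_one_sub_negExp {ν p : Measure Y} [IsProbabilityMeasure p] {l : ℝ≥0}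
    (h : ν = (l : ℝ≥0∞) • p) {F : Y → ℝ≥0∞} (hF : Measurable F) :
    ∫⁻ y, (1 - negExp (F y)) ∂ν = l * (1 - ∫⁻ y, negExp (F y) ∂p) := by
  rw [h, lintegral_smul_measure, smul_eq_mul, lintegral_sub (by fun_prop)
    ((lintegral_negExp_le_measure_univ p F).trans_lt (measure_lt_top _ _)).ne
    (ae_of_all _ fun y => negExp_le_one _)]
  simp

/-- A compound Poisson sum with intensity `ν a`, as a measurable function of `a` and of uniform
seeds. -/
theorem exists_compoundPoisson [StandardBorelSpace Y] (ν : Kernel α Y) (y₀ : Y) :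
    ∃ g : α → Seeds → ℕ → Y, Measurable (Function.uncurry g) ∧
      ∀ a, ν a Set.univ ≠ ∞ → ∀ F : Y → ℝ≥0∞, Measurable F → F y₀ = 0 →
        ∫⁻ ω, negExp (∑' i, F (g a ω i)) ∂seedsLaw = negExp (∫⁻ y, (1 - negExp (F y)) ∂ν a) := by
  have : Nonempty Y := ⟨y₀⟩
  have hrate : Measurable fun a => (ν a Set.univ).toNNReal :=
    (ν.measurable_coe MeasurableSet.univ).ennreal_toNNReal
  obtain ⟨N, hN, hNm⟩ := Kernel.exists_measurable_map_eq_unitInterval (poissonKernel hrate)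
  obtain ⟨p, hp, hpν⟩ := exists_markovKernel_smul_eq ν y₀
  obtain ⟨h, hh, hhm⟩ := Kernel.exists_measurable_map_eq_unitInterval p
  -- A Poisson number of independent marks; the remaining slots hold `y₀`, where `F` vanishes, so
  -- the random finite sum is a series over `ℕ`.
  refine ⟨fun a ω i => if i < N a ω.1 then h a (ω.2 i) else y₀, ?_, ?_⟩
  · refine measurable_pi_lambda _ fun i => Measurable.ite ?_ ?_ measurable_const
    · have h1 : Measurable fun q : α × Seeds => N q.1 q.2.1 :=
        hN.comp (measurable_fst.prodMk (measurable_fst.comp measurable_snd))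
      exact measurableSet_lt measurable_const h1
    · exact hh.comp (measurable_fst.prodMk
        ((measurable_pi_apply i).comp (measurable_snd.comp measurable_snd)))
  · intro a ha F hF hF0
    have hNa : Measurable (N a) := hN.of_uncurry_left
    have hha : Measurable (h a) := hh.of_uncurry_left
    set q : ℝ≥0∞ := ∫⁻ y, negExp (F y) ∂(p a) with hq
    have hq1 : q ≤ 1 := by simpa using lintegral_negExp_le_measure_univ (p a) F
    -- Writing `q = e^{-C}` lets the series lemma give `e^{-nC} = q^n` for `n` marks; averaging over
    -- the Poisson number follows.
    obtain ⟨C, hC⟩ := exists_negExp_eq hq1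
    have hfF : ∀ (n : ℕ) (x : Y) (i : ℕ),
        F (if i < n then x else y₀) = if i < n then F x else 0 := by
      intro n x i
      split_ifs <;> simp [hF0]
    have inner : ∀ n : ℕ, ∫⁻ u : ℕ → unitInterval,
        negExp (∑' i, if i < n then F (h a (u i)) else 0) ∂(Measure.infinitePi fun _ => volume) =
        q ^ n := by
      intro n
      rw [lintegral_negExp_tsum_infinitePi (fun _ : ℕ => (volume : Measure unitInterval))
        (fun i v => if i < n then F (h a v) else 0) (fun i => by split_ifs <;> fun_prop)
        (fun i => if i < n then C else 0)]
      · rw [← hC, ← negExp_nat_mul,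
          tsum_eq_sum (s := Finset.range n) (by simp +contextual [not_lt_of_ge])]
        congr 1
        rw [Finset.sum_congr rfl (g := fun _ => C) (by simp +contextual)]
        simp
      · intro i
        split_ifs with hi
        · rw [hC, hq, ← hhm a, lintegral_map (by fun_prop) hha]
        · simp
    simp only [hfF]
    rw [seedsLaw, lintegral_prod]
    · simp_rw [inner]
      rw [← lintegral_map (f := fun n : ℕ => q ^ n) .of_discrete hNa, hNm a]
      change ∫⁻ n, q ^ n ∂(poissonMeasure (ν a Set.univ).toNNReal) = _
      have hqt : q ≠ ∞ := (hq1.trans_lt ENNReal.one_lt_top).ne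
      rw [lintegral_countable']
      have h1 := tsum_poissonMeasure_mul_pow (ν a Set.univ).toNNReal q.toNNReal
        (by rw [← ENNReal.coe_le_coe, ENNReal.coe_toNNReal hqt]; exact_mod_cast hq1)
      rw [ENNReal.coe_toNNReal hqt] at h1
      simp_rw [mul_comm (q ^ _)]
      rw [h1, lintegral_one_sub_negExp (l := (ν a Set.univ).toNNReal) (p := p a) ?_ hF]
      · push_cast
        rw [ENNReal.coe_toNNReal hqt]
      · rw [ENNReal.coe_toNNReal ha]
        exact hpν a ha
    · refine (measurable_negExp.comp (Measurable.tsum fun i =>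
        Measurable.ite ?_ ?_ measurable_const)).aemeasurable
      · exact measurableSet_lt measurable_const (hNa.comp measurable_fst)
      · fun_prop

/-- A sum of independent compound Poisson sums with intensities `ν n a`. -/
theorem exists_poissonSeries [StandardBorelSpace Y] (ν : ℕ → Kernel α Y) (y₀ : Y) :
    ∃ g : α → (ℕ → Seeds) → ℕ → Y, Measurable (Function.uncurry g) ∧
      ∀ a, (∀ n, ν n a Set.univ ≠ ∞) → ∀ F : Y → ℝ≥0∞, Measurable F → F y₀ = 0 →
        ∫⁻ ω, negExp (∑' k, F (g a ω k)) ∂(Measure.infinitePi fun _ => seedsLaw) =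
          negExp (∑' n, ∫⁻ y, (1 - negExp (F y)) ∂ν n a) := by
  choose g hg hgF using fun n => exists_compoundPoisson (ν n) y₀
  -- Independent families are superposed into one sequence by the pairing bijection; their exponents
  -- add.
  refine ⟨fun a ω k => g k.unpair.1 a (ω k.unpair.1) k.unpair.2, ?_, ?_⟩
  · refine measurable_pi_lambda _ fun k => ?_
    exact (measurable_pi_apply _).comp ((hg k.unpair.1).comp
      (measurable_fst.prodMk ((measurable_pi_apply _).comp measurable_snd)))
  · intro a ha F hF hF0
    have h1 : ∀ ω : ℕ → Seeds, ∑' k : ℕ, F (g k.unpair.1 a (ω k.unpair.1) k.unpair.2) =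
        ∑' n, ∑' i, F (g n a (ω n) i) := by
      intro ω
      rw [← ENNReal.tsum_prod (f := fun n i => F (g n a (ω n) i)),
        ← Nat.pairEquiv.symm.tsum_eq]
      rfl
    simp_rw [h1]
    refine lintegral_negExp_tsum_infinitePi (fun _ : ℕ => seedsLaw)
      (fun n ω => ∑' i, F (g n a ω i)) (fun n => ?_) _ fun n => hgF n a (ha n) F hF hF0
    refine Measurable.tsum fun i => hF.comp ((measurable_pi_apply i).comp ?_)
    exact (hg n).of_uncurry_left

end Construction

/-! ### Lévy intensities of the gamma and noncentral gamma random measures. -/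

lemma integral_div_one_add_mul (x : ℝ) (hx : 0 ≤ x) :
    ∫ u in (0 : ℝ)..1, x / (1 + u * x) = Real.log (1 + x) := by
  have hpos : ∀ u ∈ Set.uIcc (0 : ℝ) 1, 0 < 1 + u * x := by
    intro u hu
    rw [Set.uIcc_of_le zero_le_one] at hu
    have := mul_nonneg hu.1 hx
    linarith
  rw [intervalIntegral.integral_eq_sub_of_hasDerivAt (f := fun u => Real.log (1 + u * x))]
  · simp
  · intro u hu
    have h1 : HasDerivAt (fun u => 1 + u * x) x u := by
      simpa using ((hasDerivAt_id u).mul_const x).const_add 1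
    exact h1.log (hpos u hu).ne'
  · refine ContinuousOn.intervalIntegrable ?_
    exact continuousOn_const.div (by fun_prop) fun u hu => (hpos u hu).ne'

lemma lintegral_Ioc_div_one_add_mul (x : ℝ) (hx : 0 ≤ x) :
    ∫⁻ u in Set.Ioc (0 : ℝ) 1, ENNReal.ofReal (x / (1 + u * x)) =
      ENNReal.ofReal (Real.log (1 + x)) := by
  rw [← integral_div_one_add_mul x hx, intervalIntegral.integral_of_le zero_le_one,
    ofReal_integral_eq_lintegral_ofReal]
  · have hc : ContinuousOn (fun u : ℝ => x / (1 + u * x)) (Set.uIcc 0 1) := by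
      refine continuousOn_const.div (by fun_prop) fun u hu => ?_
      rw [Set.uIcc_of_le zero_le_one] at hu
      have := mul_nonneg hu.1 hx
      linarith
    exact (intervalIntegrable_iff_integrableOn_Ioc_of_le zero_le_one).1 hc.intervalIntegrable
  · rw [EventuallyLE, ae_restrict_iff' measurableSet_Ioc]
    refine ae_of_all _ fun u hu => ?_
    have := mul_nonneg hu.1.le hx
    exact div_nonneg hx (by linarith)

/-- The measure `du / u` on `(0, 1]`, scaled by `c`. -/
def scaleMeasure (c : ℝ≥0) : Measure ℝ≥0 :=
  ((volume.restrict (Set.Ioc (0 : ℝ) 1)).withDensity fun u => ENNReal.ofReal u⁻¹).map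
    fun u => c * u.toNNReal

instance (c : ℝ≥0) : SFinite (scaleMeasure c) := by unfold scaleMeasure; infer_instance

/-- The density `1/u` turns `ucs/(1+ucs)` into `cs/(1+ucs)`, the derivative in `u` of `log(1+ucs)`.
The gamma exponent is thus a mixture over scales of the noncentral one. -/
lemma lintegral_scaleMeasure (c s : ℝ≥0) :
    ∫⁻ v : ℝ≥0, ENNReal.ofReal (v * s / (1 + v * s)) ∂(scaleMeasure c) =
      ENNReal.ofReal (Real.log (1 + c * s)) := by
  rw [scaleMeasure, lintegral_map (by fun_prop) (by fun_prop),
    lintegral_withDensity_eq_lintegral_mul _ (by fun_prop) (by fun_prop),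
    ← lintegral_Ioc_div_one_add_mul (c * s) (by positivity)]
  refine setLIntegral_congr_fun measurableSet_Ioc fun u hu => ?_
  have hu0 : 0 < u := hu.1
  simp only [Pi.mul_apply]
  rw [← ENNReal.ofReal_mul (by positivity)]
  congr 1
  rw [NNReal.coe_mul, Real.coe_toNNReal u hu0.le]
  field_simp

section Construction

variable {Θ : Type*} [MeasurableSpace Θ]

/-- An atom at `θ` with an exponential weight of mean `v`. -/
def expMark : Kernel (ℝ≥0 × Θ) (ℝ≥0 × Θ) :=
  (Kernel.id ×ₖ Kernel.const _ (gammaMeasure 1 1)).map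
    fun q : (ℝ≥0 × Θ) × ℝ => (q.1.1 * q.2.toNNReal, q.1.2)

instance : IsProbabilityMeasure (gammaMeasure 1 1) :=
  isProbabilityMeasure_gammaMeasure one_pos one_pos

instance : IsMarkovKernel (expMark (Θ := Θ)) := by
  unfold expMark
  exact Kernel.IsMarkovKernel.map _ (by fun_prop)

lemma lintegral_expMark (y : ℝ≥0 × Θ) {G : ℝ≥0 × Θ → ℝ≥0∞} (hG : Measurable G) :
    ∫⁻ z, G z ∂(expMark y) = ∫⁻ e, G (y.1 * e.toNNReal, y.2) ∂(gammaMeasure 1 1) := by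
  rw [expMark, Kernel.map_apply _ (by fun_prop), lintegral_map hG (by fun_prop),
    Kernel.prod_apply, Kernel.id_apply, Kernel.const_apply, lintegral_prod _ (by fun_prop),
    lintegral_dirac']
  fun_prop

/-- An exponential weight of mean `v` has Laplace transform `1/(1+vs)` at `s`. This single
computation serves both terms of the exponent. -/
lemma lintegral_one_sub_negExp_expMark (y : ℝ≥0 × Θ) {f : Θ → ℝ} (hf : Measurable f)
    (h0 : ∀ x, 0 ≤ f x) :
    ∫⁻ z, (1 - negExp (z.1 * ENNReal.ofReal (f z.2))) ∂(expMark y) =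
      ENNReal.ofReal (y.1 * f y.2 / (1 + y.1 * f y.2)) := by
  have hp : 0 ≤ (y.1 : ℝ) * f y.2 := mul_nonneg y.1.2 (h0 _)
  have hm : Measurable fun z : ℝ≥0 × Θ => (z.1 : ℝ≥0∞) * ENNReal.ofReal (f z.2) := by fun_prop
  rw [lintegral_one_sub_negExp (p := expMark y) (l := 1) (by simp) hm,
    lintegral_expMark y (by fun_prop)]
  have h1 := lintegral_negExp_gammaMeasure one_pos one_pos (y.1 * (f y.2).toNNReal)
  have h2 : ∀ e : ℝ, ((y.1 * e.toNNReal : ℝ≥0) : ℝ≥0∞) * ENNReal.ofReal (f y.2) =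
      ENNReal.ofReal e * ((y.1 * (f y.2).toNNReal : ℝ≥0) : ℝ≥0∞) := by
    intro e
    rw [ENNReal.ofReal, ENNReal.ofReal]
    push_cast
    ring
  simp_rw [h2]
  rw [h1, NNReal.coe_mul, Real.coe_toNNReal _ (h0 _), Real.rpow_one, ENNReal.coe_one,
    one_mul, ← ENNReal.ofReal_one, ← ENNReal.ofReal_sub _ (by positivity)]
  congr 1
  field_simp
  ring

lemma lintegral_atomicMeasure [MetricSpace Θ] (w : ℕ → ℝ≥0) (θ : ℕ → Θ) {g : Θ → ℝ≥0∞}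
    (hg : Measurable g) : ∫⁻ x, g x ∂(atomicMeasure w θ) = ∑' i, (w i : ℝ≥0∞) * g (θ i) := by
  rw [atomicMeasure, lintegral_sum_measure]
  simp_rw [lintegral_smul_measure, lintegral_dirac' _ hg, smul_eq_mul]

lemma measurable_atomicMeasure [MetricSpace Θ] {β : Type*} [MeasurableSpace β]
    {w : β → ℕ → ℝ≥0} {θ : β → ℕ → Θ} (hw : Measurable w) (hθ : Measurable θ) :
    Measurable fun b => atomicMeasure (w b) (θ b) := by
  refine Measure.measurable_of_measurable_coe _ fun s hs => ?_
  have h : ∀ b, atomicMeasure (w b) (θ b) s =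
      ∑' i, (w b i : ℝ≥0∞) * s.indicator 1 (θ b i) := by
    intro b
    simp_rw [atomicMeasure, Measure.sum_apply _ hs, Measure.smul_apply, smul_eq_mul,
      Measure.dirac_apply' _ hs]
  simp_rw [h]
  refine Measurable.tsum fun i => ?_
  have h1 : Measurable fun b => s.indicator (1 : Θ → ℝ≥0∞) (θ b i) :=
    (measurable_one.indicator hs).comp ((measurable_pi_apply i).comp hθ)
  exact ((measurable_pi_apply i).comp hw).coe_nnreal_ennreal.mul h1

variable [MetricSpace Θ] [BorelSpace Θ]

lemma sum_restrict_annulus (x₀ : Θ) (m : Measure Θ) :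
    Measure.sum (fun k => m.restrict (annulus x₀ k)) = m := by
  rw [← Measure.restrict_iUnion (pairwise_disjoint_annulus x₀) (measurableSet_annulus x₀),
    iUnion_annulus, Measure.restrict_univ]

lemma FiniteOnBounded.sFinite [Nonempty Θ] {m : Measure Θ} (hm : FiniteOnBounded m) :
    SFinite m := by
  obtain ⟨x₀⟩ := ‹Nonempty Θ›
  have : ∀ k, IsFiniteMeasure (m.restrict (annulus x₀ k)) := fun k =>
    ⟨by rw [Measure.restrict_apply_univ]; exact hm _ (isBounded_annulus x₀ k)⟩
  rw [← sum_restrict_annulus x₀ m]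
  infer_instance

/-- The part on an annulus of the Lévy intensity of `NcGaP(0, M, c⁻¹)`. -/
def noncentralPiece (c : ℝ≥0) (x₀ : Θ) (n : ℕ) : Kernel (Measure Θ) (ℝ≥0 × Θ) where
  toFun M := ((M.restrict (annulus x₀ n)).map fun θ => (c, θ)).bind expMark
  measurable' := by
    refine (Measure.measurable_bind' expMark.measurable).comp
      ((Measure.measurable_map _ (by fun_prop)).comp ?_)
    refine Measure.measurable_of_measurable_coe _ fun s hs => ?_
    simp_rw [Measure.restrict_apply hs]
    exact Measure.measurable_coe (hs.inter (measurableSet_annulus x₀ n))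

/-- The Lévy intensity of `GaP(H, c⁻¹)`. -/
def gammaIntensity {Θ : Type*} [MeasurableSpace Θ] (H : Measure Θ) (c : ℝ≥0) : Measure (ℝ≥0 × Θ) :=
  ((scaleMeasure c).prod H).bind expMark

instance {Θ : Type*} [MeasurableSpace Θ] (H : Measure Θ) [SFinite H] (c : ℝ≥0) :
    SFinite (gammaIntensity H c) := by
  unfold gammaIntensity; infer_instance

lemma noncentralPiece_univ_ne_top (c : ℝ≥0) (x₀ : Θ) (n : ℕ) {M : Measure Θ}
    (hM : FiniteOnBounded M) : noncentralPiece c x₀ n M Set.univ ≠ ∞ := by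
  have : IsFiniteMeasure (M.restrict (annulus x₀ n)) :=
    ⟨by rw [Measure.restrict_apply_univ]; exact hM _ (isBounded_annulus x₀ n)⟩
  change ((M.restrict (annulus x₀ n)).map fun θ => (c, θ)).bind expMark Set.univ ≠ ∞
  exact measure_ne_top _ _

lemma tsum_lintegral_noncentralPiece (c : ℝ≥0) (x₀ : Θ) (M : Measure Θ) {f : Θ → ℝ}
    (hf : Measurable f) (h0 : ∀ x, 0 ≤ f x) :
    ∑' n, ∫⁻ z, (1 - negExp (z.1 * ENNReal.ofReal (f z.2))) ∂(noncentralPiece c x₀ n M) =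
      ∫⁻ x, ENNReal.ofReal (c * f x / (1 + c * f x)) ∂M := by
  have h1 : ∀ n, ∫⁻ z, (1 - negExp (z.1 * ENNReal.ofReal (f z.2))) ∂(noncentralPiece c x₀ n M) =
      ∫⁻ x, ENNReal.ofReal (c * f x / (1 + c * f x)) ∂(M.restrict (annulus x₀ n)) := by
    intro n
    change ∫⁻ z, (1 - negExp (z.1 * ENNReal.ofReal (f z.2)))
      ∂(((M.restrict (annulus x₀ n)).map fun θ => (c, θ)).bind expMark) = _
    rw [Measure.lintegral_bind expMark.aemeasurable (by fun_prop)]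
    simp_rw [lintegral_one_sub_negExp_expMark _ hf h0]
    rw [lintegral_map (by fun_prop) (by fun_prop)]
  simp_rw [h1]
  rw [← lintegral_sum_measure, sum_restrict_annulus]

lemma lintegral_gammaIntensity {Θ : Type*} [MeasurableSpace Θ] (H : Measure Θ) [SFinite H]
    (c : ℝ≥0) {f : Θ → ℝ} (hf : Measurable f) (h0 : ∀ x, 0 ≤ f x) :
    ∫⁻ z, (1 - negExp (z.1 * ENNReal.ofReal (f z.2))) ∂(gammaIntensity H c) =
      ∫⁻ x, ENNReal.ofReal (Real.log (1 + c * f x)) ∂H := by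
  rw [gammaIntensity, Measure.lintegral_bind expMark.aemeasurable (by fun_prop)]
  simp_rw [lintegral_one_sub_negExp_expMark _ hf h0]
  rw [lintegral_prod_symm _ (by fun_prop)]
  refine lintegral_congr fun x => ?_
  have := lintegral_scaleMeasure c (f x).toNNReal
  rwa [Real.coe_toNNReal _ (h0 x)] at this

lemma exists_poissonSeries_prod {α Θ : Type*} [MeasurableSpace α] [MeasurableSpace Θ]
    [StandardBorelSpace Θ] (ν : ℕ → Kernel α (ℝ≥0 × Θ)) (x₀ : Θ) :
    ∃ (w : α → (ℕ → Seeds) → ℕ → ℝ≥0) (θ : α → (ℕ → Seeds) → ℕ → Θ),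
      Measurable (Function.uncurry w) ∧ Measurable (Function.uncurry θ) ∧
      ∀ a, (∀ n, ν n a Set.univ ≠ ∞) → ∀ F : ℝ≥0 × Θ → ℝ≥0∞, Measurable F → F (0, x₀) = 0 →
        ∫⁻ ω, negExp (∑' k, F (w a ω k, θ a ω k)) ∂(Measure.infinitePi fun _ => seedsLaw) =
          negExp (∑' n, ∫⁻ y, (1 - negExp (F y)) ∂ν n a) := by
  -- The padding mark has weight `0` and adds nothing to an atomic measure.
  obtain ⟨g, hg, hgF⟩ := exists_poissonSeries ν (0, x₀)
  exact ⟨fun a ω i => (g a ω i).1, fun a ω i => (g a ω i).2,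
    measurable_pi_lambda _ fun i => measurable_fst.comp ((measurable_pi_apply i).comp hg),
    measurable_pi_lambda _ fun i => measurable_snd.comp ((measurable_pi_apply i).comp hg), hgF⟩

/-- A noncentral gamma random measure with atoms that are measurable functions of the noncentrality
measure and of uniform seeds. -/
theorem exists_ncGammaProcess [PolishSpace Θ] [Nonempty Θ] {H : Measure Θ}
    (hH : FiniteOnBounded H) (c : ℝ≥0) :
    ∃ (w : Measure Θ → (ℕ → Seeds) → ℕ → ℝ≥0) (θ : Measure Θ → (ℕ → Seeds) → ℕ → Θ),
      Measurable (Function.uncurry w) ∧ Measurable (Function.uncurry θ) ∧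
      ∀ M, FiniteOnBounded M → IsNcGammaProcessLaw H M ((c : ℝ)⁻¹)
        ((Measure.infinitePi fun _ => seedsLaw).map fun ω => atomicMeasure (w M ω) (θ M ω)) := by
  have := hH.sFinite
  obtain ⟨x₀⟩ := id ‹Nonempty Θ›
  -- Total intensities may be infinite (`du/u` always is near `0`), so they are cut into finite
  -- pieces: the noncentral part by annuli, measurably in `M`, and the fixed gamma part by
  -- s-finiteness.
  let ν : ℕ → Kernel (Measure Θ) (ℝ≥0 × Θ) := fun n =>
    noncentralPiece c x₀ n + Kernel.const _ (sfiniteSeq (gammaIntensity H c) n)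
  obtain ⟨w, θ, hw, hθ, hF⟩ := exists_poissonSeries_prod ν x₀
  refine ⟨w, θ, hw, hθ, fun M hM => ?_⟩
  have hwM : Measurable (w M) := hw.of_uncurry_left
  have hθM : Measurable (θ M) := hθ.of_uncurry_left
  have hmeas : Measurable fun ω => atomicMeasure (w M ω) (θ M ω) :=
    measurable_atomicMeasure hwM hθM
  have := Measure.isProbabilityMeasure_map (μ := Measure.infinitePi fun _ : ℕ => seedsLaw)
    hmeas.aemeasurable
  rw [isNcGammaProcessLaw_iff hH hM]
  intro f hf
  have hLm : Measurable fun m : Measure Θ => negExp (∫⁻ x, ENNReal.ofReal (f x) ∂m) :=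
    measurable_negExp.comp (measurable_lintegral_ofReal hf)
  rw [laplaceFunctional, lintegral_map hLm hmeas]
  simp_rw [lintegral_atomicMeasure _ _ hf.1.ennreal_ofReal]
  have hfm := hf.1
  rw [hF M (fun n => ?_) (fun z => z.1 * ENNReal.ofReal (f z.2)) (by fun_prop) (by simp)]
  · have hν : ∀ n, ν n M = noncentralPiece c x₀ n M + sfiniteSeq (gammaIntensity H c) n :=
      fun n => by rw [_root_.add_apply, Kernel.const_apply]
    simp_rw [hν, lintegral_add_measure]
    rw [ENNReal.tsum_add, tsum_lintegral_noncentralPiece c x₀ M hf.1 hf.2.1,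
      ← lintegral_sum_measure, sum_sfiniteSeq, lintegral_gammaIntensity H c hf.1 hf.2.1, add_comm,
      ncExponent]
  · rw [_root_.add_apply, Kernel.const_apply, Measure.add_apply]
    exact ENNReal.add_ne_top.2 ⟨noncentralPiece_univ_ne_top c x₀ n hM, measure_ne_top _ _⟩

end Construction

/-! ### Thinned weights as functions of independent uniform variables. -/

section Thinning

variable {Ω 𝓖 : Type*} [MeasurableSpace Ω] [MeasurableSpace 𝓖]

/-- The law of independent uniform variables. -/
def uniformLaw : Measure (ℕ → unitInterval) := Measure.infinitePi fun _ => volume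

instance : IsProbabilityMeasure uniformLaw := by unfold uniformLaw; infer_instance

/-- Weights computed from `weights g` and independent uniform variables. -/
def couple (h : ℝ≥0 → unitInterval → ℝ≥0) (weights : 𝓖 → ℕ → ℝ≥0) (b : ℝ≥0)
    (q : 𝓖 × (ℕ → unitInterval)) : ℕ → ℝ≥0 :=
  fun i => h (b * weights q.1 i) (q.2 i)

lemma measurable_couple {h : ℝ≥0 → unitInterval → ℝ≥0} (hh : Measurable (Function.uncurry h))
    {weights : 𝓖 → ℕ → ℝ≥0} (hw : Measurable weights) (b : ℝ≥0) :
    Measurable (couple h weights b) := by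
  refine measurable_pi_lambda _ fun i => hh.comp (Measurable.prodMk ?_ ?_)
  · exact ((measurable_pi_apply i).comp (hw.comp measurable_fst)).const_mul b
  · exact (measurable_pi_apply i).comp measurable_snd

variable {h : ℝ≥0 → unitInterval → ℝ≥0} {r : ℝ}

lemma ncGammaLaw_apply_eq (hh : Measurable (Function.uncurry h))
    (hlaw : ∀ b, volume.map (fun v => (h b v : ℝ)) = ncGammaLaw 0 b r) (b : ℝ≥0)
    {B : Set ℝ} (hB : MeasurableSet B) :
    ncGammaLaw 0 b r B = volume {v | (h b v : ℝ) ∈ B} := by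
  have hhb : Measurable (h b) := hh.of_uncurry_left
  rw [← hlaw b, Measure.map_apply (by fun_prop) hB]
  rfl

/-- The joint law of `G` and of the coupled weights, on rectangles. -/
lemma map_couple_apply (μ : Measure 𝓖) [IsProbabilityMeasure μ]
    (hh : Measurable (Function.uncurry h))
    (hlaw : ∀ b, volume.map (fun v => (h b v : ℝ)) = ncGammaLaw 0 b r)
    {weights : 𝓖 → ℕ → ℝ≥0} (hw : Measurable weights) (b : ℝ≥0) (S : Finset ℕ)
    {B : ℕ → Set ℝ} (hB : ∀ i, MeasurableSet (B i)) {D : Set 𝓖} (hD : MeasurableSet D) :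
    (μ.prod uniformLaw).map (fun q => (q.1, couple h weights b q))
        (D ×ˢ ⋂ i ∈ S, {y | (y i : ℝ) ∈ B i}) =
      ∫⁻ g in D, ∏ i ∈ S, ncGammaLaw 0 (b * weights g i) r (B i) ∂μ := by
  have hc := measurable_couple hh hw b
  have hE : MeasurableSet (⋂ i ∈ S, {y : ℕ → ℝ≥0 | (y i : ℝ) ∈ B i}) :=
    Finset.measurableSet_biInter S fun i _ => by
      have : Measurable fun y : ℕ → ℝ≥0 => (y i : ℝ) := by fun_prop
      exact this (hB i)
  have hm : Measurable fun q : 𝓖 × (ℕ → unitInterval) => (q.1, couple h weights b q) :=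
    measurable_fst.prodMk hc
  rw [Measure.map_apply hm (hD.prod hE), Measure.prod_apply (hm (hD.prod hE)),
    ← lintegral_indicator hD]
  refine lintegral_congr fun g => ?_
  by_cases hg : g ∈ D
  · rw [Set.indicator_of_mem hg]
    have hset : Prod.mk g ⁻¹' ((fun q => (q.1, couple h weights b q)) ⁻¹'
        (D ×ˢ ⋂ i ∈ S, {y | (y i : ℝ) ∈ B i})) =
        (S : Set ℕ).pi fun i => {v | (h (b * weights g i) v : ℝ) ∈ B i} := by
      ext u
      simp [hg, couple]
    rw [hset, uniformLaw, Measure.infinitePi_pi]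
    · exact Finset.prod_congr rfl fun i _ => (ncGammaLaw_apply_eq hh hlaw _ (hB i)).symm
    · intro i _
      have hhb : Measurable (h (b * weights g i)) := hh.of_uncurry_left
      have : Measurable fun v => (h (b * weights g i) v : ℝ) := by fun_prop
      exact this (hB i)
  · rw [Set.indicator_of_notMem hg]
    have hset : Prod.mk g ⁻¹' ((fun q => (q.1, couple h weights b q)) ⁻¹'
        (D ×ˢ ⋂ i ∈ S, {y | (y i : ℝ) ∈ B i})) = ∅ := by
      ext u
      simp [hg]
    rw [hset, measure_empty]

/-- For fixed `D` this compares two finite measures on sequences, where cylinders form a generating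
π-system. -/
lemma ext_prod_sequence {ν₁ ν₂ : Measure (𝓖 × (ℕ → ℝ≥0))} [IsFiniteMeasure ν₁] [IsFiniteMeasure ν₂]
    (heq : ∀ (S : Finset ℕ) (B : ℕ → Set ℝ), (∀ i, MeasurableSet (B i)) → ∀ D : Set 𝓖,
      MeasurableSet D → ν₁ (D ×ˢ ⋂ i ∈ S, {y | (y i : ℝ) ∈ B i}) =
        ν₂ (D ×ˢ ⋂ i ∈ S, {y | (y i : ℝ) ∈ B i})) : ν₁ = ν₂ := by
  refine Measure.ext_prod fun {D E} hD hE => ?_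
  have hDu : MeasurableSet (D ×ˢ (Set.univ : Set (ℕ → ℝ≥0))) := hD.prod MeasurableSet.univ
  have key : (ν₁.restrict (D ×ˢ Set.univ)).map Prod.snd =
      (ν₂.restrict (D ×ˢ Set.univ)).map Prod.snd := by
    have happ : ∀ (ν : Measure (𝓖 × (ℕ → ℝ≥0))) (E : Set (ℕ → ℝ≥0)), MeasurableSet E →
        (ν.restrict (D ×ˢ Set.univ)).map Prod.snd E = ν (D ×ˢ E) := by
      intro ν E hE
      rw [Measure.map_apply measurable_snd hE, Measure.restrict_apply (measurable_snd hE)]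
      congr 1
      ext q
      simp [and_comm]
    refine ext_of_generate_finite _ generateFrom_squareCylinders.symm
      (isPiSystem_squareCylinders (fun _ => MeasurableSpace.isPiSystem_measurableSet) (by simp))
      ?_ ?_
    · rintro _ ⟨S, C, hC, rfl⟩
      have hCm : ∀ i, MeasurableSet (C i) := fun i => hC i (Set.mem_univ i)
      -- Cylinders have sides in `ℝ≥0`, the hypothesis has sides in `ℝ`; images under the measurable
      -- embedding pass from one to the other.
      have hset : (S : Set ℕ).pi C = ⋂ i ∈ S, {y : ℕ → ℝ≥0 | (y i : ℝ) ∈ (↑) '' C i} := by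
        ext y
        simp
      have hBm : ∀ i, MeasurableSet (((↑) : ℝ≥0 → ℝ) '' C i) := fun i =>
        (MeasurableEmbedding.subtype_coe measurableSet_Ici).measurableSet_image.2 (hCm i)
      have hm : MeasurableSet ((S : Set ℕ).pi C) :=
        MeasurableSet.pi S.countable_toSet fun i _ => hCm i
      rw [happ _ _ hm, happ _ _ hm, hset]
      exact heq S _ hBm D hD
    · rw [happ _ _ MeasurableSet.univ, happ _ _ MeasurableSet.univ]
      simpa using heq ∅ (fun _ => Set.univ) (fun _ => MeasurableSet.univ) D hD
  have := congrArg (fun ν => ν E) key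
  simp only [Measure.map_apply measurable_snd hE,
    Measure.restrict_apply (measurable_snd hE)] at this
  convert this using 2 <;> (ext q; simp [and_comm])

variable {P : Measure Ω} [IsProbabilityMeasure P] {G : Ω → 𝓖} {weights : 𝓖 → ℕ → ℝ≥0}
  {b : ℝ≥0} {wU : ℕ → Ω → ℝ≥0}

lemma measurable_prod_ncGammaLaw_real (hw : Measurable weights) (S : Finset ℕ) {B : ℕ → Set ℝ}
    (hB : ∀ i, MeasurableSet (B i)) :
    Measurable fun g => ∏ i ∈ S, (ncGammaLaw 0 (b * weights g i) r).real (B i) := by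
  refine Finset.measurable_prod _ fun i _ => ?_
  have h1 : Measurable fun g => b * weights g i :=
    ((measurable_pi_apply i).comp hw).const_mul b
  exact (((ncGammaKernel r).measurable_coe (hB i)).comp h1).ennreal_toReal

lemma ofReal_prod_ncGammaLaw_real (hr : 0 < r) (y : ℕ → ℝ≥0) (S : Finset ℕ) (B : ℕ → Set ℝ) :
    ENNReal.ofReal (∏ i ∈ S, (ncGammaLaw 0 (y i) r).real (B i)) =
      ∏ i ∈ S, ncGammaLaw 0 (y i) r (B i) := by
  rw [ENNReal.ofReal_prod_of_nonneg fun i _ => measureReal_nonneg]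
  refine Finset.prod_congr rfl fun i _ => ?_
  have := isProbabilityMeasure_ncGammaLaw_zero (y i) hr
  exact ofReal_measureReal

lemma abs_prod_ncGammaLaw_real_le_one (hr : 0 < r) (y : ℕ → ℝ≥0) (S : Finset ℕ)
    (B : ℕ → Set ℝ) : |∏ i ∈ S, (ncGammaLaw 0 (y i) r).real (B i)| ≤ 1 := by
  rw [Finset.abs_prod]
  refine Finset.prod_le_one (fun i _ => abs_nonneg _) fun i _ => ?_
  have := isProbabilityMeasure_ncGammaLaw_zero (y i) hr
  rw [abs_of_nonneg measureReal_nonneg]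
  exact measureReal_le_one

lemma setLIntegral_prod_eq_ofReal (hr : 0 < r) (hG : Measurable G) (hw : Measurable weights)
    (S : Finset ℕ) {B : ℕ → Set ℝ} (hB : ∀ i, MeasurableSet (B i)) {D : Set 𝓖}
    (hD : MeasurableSet D) :
    ∫⁻ g in D, ∏ i ∈ S, ncGammaLaw 0 (b * weights g i) r (B i) ∂(P.map G) =
      ENNReal.ofReal (∫ ω in G ⁻¹' D,
        ∏ i ∈ S, (ncGammaLaw 0 (b * weights (G ω) i) r).real (B i) ∂P) := by
  have hm := measurable_prod_ncGammaLaw_real (b := b) (r := r) hw S hB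
  rw [ofReal_integral_eq_lintegral_ofReal]
  · simp_rw [← ofReal_prod_ncGammaLaw_real hr (fun i => b * weights _ i) S B]
    rw [setLIntegral_map hD hm.ennreal_ofReal hG]
  · refine Integrable.of_bound (hm.comp hG).aestronglyMeasurable 1 (ae_of_all _ fun ω => ?_)
    exact abs_prod_ncGammaLaw_real_le_one hr (fun i => b * weights (G ω) i) S B
  · exact ae_of_all _ fun ω => Finset.prod_nonneg fun i _ => measureReal_nonneg

/-- Thinned weights are those that have the same joint law with the conditioning variable as
the weights computed from independent uniform variables. -/
theorem isThinnedWeights_iff_map_eq (hr : 0 < r) (hh : Measurable (Function.uncurry h))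
    (hlaw : ∀ b, volume.map (fun v => (h b v : ℝ)) = ncGammaLaw 0 b r)
    (hG : Measurable G) (hw : Measurable weights) (hwU : ∀ i, Measurable (wU i)) :
    IsThinnedWeights P (MeasurableSpace.comap G inferInstance) b r
        (fun i ω => weights (G ω) i) wU ↔
      P.map (fun ω => (G ω, fun i => wU i ω)) =
        ((P.map G).prod uniformLaw).map (fun q => (q.1, couple h weights b q)) := by
  have := Measure.isProbabilityMeasure_map (μ := P) hG.aemeasurable
  have hGw : Measurable fun ω => (G ω, fun i => wU i ω) := hG.prodMk (measurable_pi_lambda _ hwU)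
  have hE : ∀ (S : Finset ℕ) (B : ℕ → Set ℝ), (∀ i, MeasurableSet (B i)) →
      MeasurableSet (⋂ i ∈ S, {ω | (wU i ω : ℝ) ∈ B i}) := fun S B hB =>
    Finset.measurableSet_biInter S fun i _ => by
      have : Measurable fun ω => (wU i ω : ℝ) := (hwU i).coe_nnreal_real
      exact this (hB i)
  have hE' : ∀ (S : Finset ℕ) (B : ℕ → Set ℝ), (∀ i, MeasurableSet (B i)) →
      MeasurableSet (⋂ i ∈ S, {y : ℕ → ℝ≥0 | (y i : ℝ) ∈ B i}) := fun S B hB =>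
    Finset.measurableSet_biInter S fun i _ => by
      have : Measurable fun y : ℕ → ℝ≥0 => (y i : ℝ) := by fun_prop
      exact this (hB i)
  have hleft : ∀ (S : Finset ℕ) (B : ℕ → Set ℝ), (∀ i, MeasurableSet (B i)) → ∀ D : Set 𝓖,
      MeasurableSet D → P.map (fun ω => (G ω, fun i => wU i ω))
        (D ×ˢ ⋂ i ∈ S, {y | (y i : ℝ) ∈ B i}) =
      ENNReal.ofReal (∫ ω in G ⁻¹' D,
        (⋂ i ∈ S, {ω | (wU i ω : ℝ) ∈ B i}).indicator (fun _ => (1 : ℝ)) ω ∂P) := by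
    intro S B hB D hD
    rw [Measure.map_apply hGw (hD.prod (hE' S B hB)), integral_indicator_const _ (hE S B hB),
      smul_eq_mul, mul_one, ofReal_measureReal, Measure.restrict_apply (hE S B hB)]
    congr 1
    ext ω
    simp [and_comm]
  have hint : ∀ (S : Finset ℕ) (B : ℕ → Set ℝ), (∀ i, MeasurableSet (B i)) →
      Integrable ((⋂ i ∈ S, {ω | (wU i ω : ℝ) ∈ B i}).indicator (fun _ => (1 : ℝ))) P :=
    fun S B hB => (integrable_const 1).indicator (hE S B hB)
  have hm := fun (S : Finset ℕ) (B : ℕ → Set ℝ) (hB : ∀ i, MeasurableSet (B i)) =>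
    measurable_prod_ncGammaLaw_real (b := b) (r := r) hw S hB
  constructor
  · intro hT
    have : IsProbabilityMeasure (P.map (fun ω => (G ω, fun i => wU i ω))) :=
      Measure.isProbabilityMeasure_map hGw.aemeasurable
    have : IsProbabilityMeasure
        (((P.map G).prod uniformLaw).map (fun q => (q.1, couple h weights b q))) :=
      Measure.isProbabilityMeasure_map
        (measurable_fst.prodMk (measurable_couple hh hw b)).aemeasurable
    -- On a rectangle the joint law is the integral of the conditional probability over `G ∈ D`, by
    -- the defining property of conditional expectation. The converse reads the same identity
    -- backwards.
    refine ext_prod_sequence fun S B hB D hD => ?_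
    rw [map_couple_apply (P.map G) hh hlaw hw b S hB hD,
      setLIntegral_prod_eq_ofReal hr hG hw S hB hD, hleft S B hB D hD,
      ← setIntegral_condExp hG.comap_le (hint S B hB) ⟨D, hD, rfl⟩]
    congr 1
    exact setIntegral_congr_ae (hG hD) ((hT S B hB).mono fun ω hω _ => hω)
  · intro heq S B hB
    refine (ae_eq_condExp_of_forall_setIntegral_eq hG.comap_le (hint S B hB) ?_ ?_ ?_).symm
    · intro s _ _
      refine (Integrable.of_bound ((hm S B hB).comp hG).aestronglyMeasurable 1
        (ae_of_all _ fun ω => ?_)).integrableOn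
      exact abs_prod_ncGammaLaw_real_le_one hr (fun i => b * weights (G ω) i) S B
    · rintro _ ⟨D, hD, rfl⟩ _
      have h1 := hleft S B hB D hD
      rw [heq, map_couple_apply (P.map G) hh hlaw hw b S hB hD,
        setLIntegral_prod_eq_ofReal hr hG hw S hB hD] at h1
      exact (ENNReal.ofReal_eq_ofReal_iff
        (integral_nonneg fun ω => Finset.prod_nonneg fun i _ => measureReal_nonneg)
        (integral_nonneg fun ω => Set.indicator_nonneg (fun _ _ => zero_le_one) ω)).1 h1
    · exact ((hm S B hB).comp (comap_measurable G)).stronglyMeasurable.aestronglyMeasurable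

/-- The Laplace functional of the thinned series, given the atoms. -/
lemma lintegral_negExp_couple {𝓖 : Type*} {weights : 𝓖 → ℕ → ℝ≥0} {c : ℝ≥0}
    (hc : 0 < c) (hh : Measurable (Function.uncurry h))
    (hlaw : ∀ b, volume.map (fun v => (h b v : ℝ)) = ncGammaLaw 0 b (c : ℝ)⁻¹)
    (g : 𝓖) (y : ℕ → ℝ) (hy : ∀ i, 0 ≤ y i) :
    ∫⁻ u, negExp (∑' i, (couple h weights b (g, u) i : ℝ≥0∞) * ENNReal.ofReal (y i)) ∂uniformLaw =
      negExp (b * ∑' i, (weights g i : ℝ≥0∞) * ENNReal.ofReal (c * y i / (1 + c * y i))) := by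
  have hhm : ∀ i, Measurable (h (b * weights g i)) := fun i => hh.of_uncurry_left
  simp only [couple]
  rw [uniformLaw, lintegral_negExp_tsum_infinitePi (fun _ : ℕ => (volume : Measure unitInterval))
    (fun i v => (h (b * weights g i) v : ℝ≥0∞) * ENNReal.ofReal (y i)) (fun i => by fun_prop)
    (fun i => (b * weights g i : ℝ≥0) * ENNReal.ofReal (c * y i / (1 + c * y i))),
    ← ENNReal.tsum_mul_left]
  · simp_rw [← mul_assoc]
    push_cast
    rfl
  · intro i
    have h1 := lintegral_negExp_ncGammaLaw_zero (b * weights g i) hc (y i).toNNReal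
    rw [Real.coe_toNNReal _ (hy i), ← hlaw, lintegral_map (by fun_prop) (by fun_prop)] at h1
    simp_rw [ENNReal.ofReal_coe_nnreal] at h1
    exact h1

/-- The probability that a thinned weight vanishes. -/
lemma condExp_thinned_eq_zero {Ω : Type*} {m m₀ : MeasurableSpace Ω} {P : Measure Ω}
    [IsProbabilityMeasure P] {w wU : ℕ → Ω → ℝ≥0} (hm : m ≤ m₀)
    (hT : IsThinnedWeights P m b r w wU) (i : ℕ)
    (hi : MeasurableSpace.comap (w i) inferInstance ≤ m) :
    P⟦{ω | wU i ω = 0} | MeasurableSpace.comap (w i) inferInstance⟧ =ᵐ[P]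
      fun ω => Real.exp (-(b * w i ω : ℝ)) := by
  have h1 := hT {i} (fun _ => {0}) (fun _ => measurableSet_singleton 0)
  have h2 : ⋂ j ∈ ({i} : Finset ℕ), {ω | (wU j ω : ℝ) ∈ ({0} : Set ℝ)} = {ω | wU i ω = 0} := by
    ext ω
    simp
  have h3 : ∀ ω, ∏ j ∈ ({i} : Finset ℕ), (ncGammaLaw 0 (b * w j ω) r).real {0} =
      Real.exp (-(b * w i ω : ℝ)) := by
    intro ω
    rw [Finset.prod_singleton, measureReal_def, ncGammaLaw_zero_singleton_zero,
      ENNReal.toReal_ofReal (Real.exp_pos _).le, NNReal.coe_mul]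
  rw [h2] at h1
  simp only [h3] at h1
  have h4 : Measurable[MeasurableSpace.comap (w i) inferInstance]
      fun ω => Real.exp (-(b * w i ω : ℝ)) := by
    have : Measurable fun y : ℝ≥0 => Real.exp (-(b * y : ℝ)) := by fun_prop
    exact this.comp (comap_measurable (w i))
  have h5 : Integrable (fun ω => Real.exp (-(b * w i ω : ℝ))) P := by
    refine Integrable.of_bound (h4.mono (hi.trans hm) le_rfl).aestronglyMeasurable 1
      (ae_of_all _ fun ω => ?_)
    rw [Real.norm_eq_abs, Real.abs_exp, Real.exp_le_one_iff, neg_nonpos]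
    positivity
  -- Tower property: the probability given the larger σ-algebra already depends on `w i` alone.
  refine (condExp_condExp_of_le hi hm).symm.trans ((condExp_congr_ae h1).trans ?_)
  rw [condExp_of_stronglyMeasurable (hi.trans hm) h4.stronglyMeasurable h5]

end Thinning

/-! ### Atoms of the states. -/

section States

variable {Θ : Type*} [MetricSpace Θ] [MeasurableSpace Θ]

lemma measurable_past {Θ : Type*} [MeasurableSpace Θ] {Ω : Type*} [MeasurableSpace Ω]
    {X : ℕ → Ω → Measure Θ} {t : ℕ} (hX : ∀ s, 1 ≤ s → s ≤ t → Measurable (X s)) :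
    Measurable (past X t) :=
  measurable_pi_lambda _ fun s => hX s s.2.1 s.2.2

lemma measurableSet_finiteOnBounded [BorelSpace Θ] [Nonempty Θ] :
    MeasurableSet {m : Measure Θ | FiniteOnBounded m} := by
  obtain ⟨x₀⟩ := ‹Nonempty Θ›
  have : {m : Measure Θ | FiniteOnBounded m} = ⋂ k, {m | m (annulus x₀ k) < ∞} := by
    ext m
    simp only [Set.mem_iInter, Set.mem_ofPred_eq]
    exact ⟨fun h k => h _ (isBounded_annulus x₀ k), FiniteOnBounded.of_annulus x₀⟩
  rw [this]
  exact MeasurableSet.iInter fun k =>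
    measurableSet_lt (Measure.measurable_coe (measurableSet_annulus x₀ k)) measurable_const

lemma ae_map_finiteOnBounded [BorelSpace Θ] [Nonempty Θ] {Ω : Type*} [MeasurableSpace Ω]
    {P : Measure Ω} {X : Ω → Measure Θ} (hX : Measurable X)
    (h : ∀ᵐ ω ∂P, FiniteOnBounded (X ω)) : ∀ᵐ m ∂(P.map X), FiniteOnBounded m :=
  (ae_map_iff hX.aemeasurable measurableSet_finiteOnBounded).2 h

/-- Allows an abstract transition kernel to be replaced by the explicit atomic construction. -/
lemma IsNcGammaProcessLaw.unique [BorelSpace Θ] [Nonempty Θ] {H M : Measure Θ}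
    (hH : FiniteOnBounded H) (hM : FiniteOnBounded M) {c : ℝ≥0} {Q Q' : Measure (Measure Θ)}
    (hQ : IsNcGammaProcessLaw H M (c : ℝ)⁻¹ Q) (hQ' : IsNcGammaProcessLaw H M (c : ℝ)⁻¹ Q') :
    Q = Q' := by
  have := hQ.isProbabilityMeasure
  have := hQ'.isProbabilityMeasure
  refine ext_of_laplaceFunctional (fun f hf => ?_) hQ.finiteOnBounded
  rw [(isNcGammaProcessLaw_iff hH hM c Q).1 hQ f hf,
    (isNcGammaProcessLaw_iff hH hM c Q').1 hQ' f hf]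

lemma IsMARG1.measurable_past {Ω : Type*} [MeasurableSpace Ω] {P : Measure Ω} {H : Measure Θ}
    {β c : ℕ → ℝ≥0} {W : ℕ → Ω → Measure Θ} (hW : IsMARG1 P H β c W) (t : ℕ) :
    Measurable (past W t) :=
  MARG.measurable_past fun s hs _ => hW.measurable s hs

lemma map_lastState_past {Ω : Type*} [MeasurableSpace Ω] {P : Measure Ω} {H : Measure Θ}
    {β c : ℕ → ℝ≥0} {W : ℕ → Ω → Measure Θ} (hW : IsMARG1 P H β c W) {t : ℕ} (ht : 1 ≤ t) :
    (P.map (past W t)).map (lastState ht) = P.map (W t) := by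
  rw [Measure.map_map (measurable_lastState ht) (hW.measurable_past t)]
  rfl

section OneStep

variable {Ω : Type*} [MeasurableSpace Ω] {P : Measure Ω} [IsProbabilityMeasure P] {H : Measure Θ}
  {β c : ℕ → ℝ≥0} {W : ℕ → Ω → Measure Θ}

lemma lintegral_map_past_next {Θ : Type*} [MeasurableSpace Θ] {W : ℕ → Ω → Measure Θ}
    {t : ℕ} {κ : Kernel (Measure Θ) (Measure Θ)} [IsMarkovKernel κ]
    (ht : 1 ≤ t) (hκ : HasCondDistrib (W (t + 1)) (past W t)
        (κ.comap (lastState ht) (measurable_lastState ht)) P)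
    {F : (Set.Icc 1 t → Measure Θ) × Measure Θ → ℝ≥0∞} (hF : Measurable F) :
    ∫⁻ q, F q ∂(P.map fun ω => (past W t ω, W (t + 1) ω)) =
      ∫⁻ g, ∫⁻ m, F (g, m) ∂(κ (lastState ht g)) ∂(P.map (past W t)) := by
  rw [HasLaw.map_eq hκ, Measure.lintegral_compProd hF]
  simp_rw [Kernel.comap_apply]

/-- Every state after the first is the image of a random sequence of atoms. -/
theorem IsMARG1.exists_atoms_law [BorelSpace Θ] [Nonempty Θ] [PolishSpace Θ]
    (hW : IsMARG1 P H β c W) {t : ℕ} (ht : 1 ≤ t) (hatom : t = 1 → IsAtomic P (W 1)) :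
    ∃ σ : Measure ((ℕ → ℝ≥0) × (ℕ → Θ)), IsProbabilityMeasure σ ∧
      σ.map (fun q => atomicMeasure q.1 q.2) = P.map (W t) := by
  have hφ : Measurable fun q : (ℕ → ℝ≥0) × (ℕ → Θ) => atomicMeasure q.1 q.2 :=
    measurable_atomicMeasure measurable_fst measurable_snd
  rcases ht.eq_or_lt with rfl | ht1
  · obtain ⟨w, θ, hw, hθ, hX⟩ := hatom rfl
    have hm : Measurable fun ω => ((fun i => w i ω), (fun i => θ i ω)) :=
      (measurable_pi_lambda _ hw).prodMk (measurable_pi_lambda _ hθ)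
    refine ⟨P.map fun ω => ((fun i => w i ω), (fun i => θ i ω)),
      Measure.isProbabilityMeasure_map hm.aemeasurable, ?_⟩
    rw [Measure.map_map hφ hm]
    exact Measure.map_congr (hX.mono fun ω hω => hω.symm)
  · obtain ⟨s, rfl⟩ : ∃ s, t = s + 1 := ⟨t - 1, by omega⟩
    have hs : 1 ≤ s := by omega
    obtain ⟨κ, hκ, hκn, hκd⟩ := hW.transition s hs
    obtain ⟨w, θ, hw, hθ, hQ⟩ := exists_ncGammaProcess hW.base (c (s + 1))
    let U : Measure (ℕ → Seeds) := Measure.infinitePi fun _ => seedsLaw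
    have := Measure.isProbabilityMeasure_map (μ := P) (hW.measurable s hs).aemeasurable
    have hm : Measurable fun q : Measure Θ × (ℕ → Seeds) =>
        (w (β (s + 1) • q.1) q.2, θ (β (s + 1) • q.1) q.2) := by
      have h1 : Measurable fun q : Measure Θ × (ℕ → Seeds) => (β (s + 1) • q.1, q.2) := by
        refine Measurable.prodMk ?_ measurable_snd
        refine Measure.measurable_of_measurable_coe _ fun A hA => ?_
        simp_rw [Measure.smul_apply, ENNReal.smul_def, smul_eq_mul]
        exact ((Measure.measurable_coe hA).comp measurable_fst).const_mul _
      exact (hw.comp h1).prodMk (hθ.comp h1)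
    refine ⟨((P.map (W s)).prod U).map _, Measure.isProbabilityMeasure_map hm.aemeasurable, ?_⟩
    rw [Measure.map_map hφ hm]
    ext A hA
    -- The law of `W (s + 1)` averages the transition laws, each of which is the law of the series
    -- built from `β (s + 1) • m` and fresh seeds. Hence only the law of the state, not the state
    -- itself, is shown to be atomic here.
    have hpair : P.map (W (s + 1)) A = ∫⁻ m, κ m A ∂(P.map (W s)) := by
      have hF : Measurable fun q : (Set.Icc 1 s → Measure Θ) × Measure Θ =>
          A.indicator (1 : Measure Θ → ℝ≥0∞) q.2 :=
        (measurable_one.indicator hA).comp measurable_snd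
      have h1 := lintegral_map_past_next hs hκd hF
      have hW1 := hW.measurable (s + 1) (by omega)
      have hWp := hW.measurable_past s
      rw [lintegral_map hF (hWp.prodMk hW1)] at h1
      simp only [lintegral_indicator_one hA] at h1
      rw [← lintegral_indicator_one hA, lintegral_map (measurable_one.indicator hA) hW1, h1,
        ← map_lastState_past hW hs, lintegral_map (κ.measurable_coe hA) (measurable_lastState hs)]
    rw [hpair, Measure.map_apply (hφ.comp hm) hA, Measure.prod_apply ((hφ.comp hm) hA)]
    refine lintegral_congr_ae ?_
    filter_upwards [hκn, ae_map_finiteOnBounded (hW.measurable s hs) (hW.finiteOnBounded s hs)]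
      with m hm1 hm2
    rw [hm1.unique hW.base (hm2.smul _) (hQ _ (hm2.smul _)), Measure.map_apply _ hA]
    · rfl
    · exact measurable_atomicMeasure hw.of_uncurry_left hθ.of_uncurry_left

end OneStep

section Extension

/-- Countably many test sets suffice: on each annulus the measures are finite, and after embedding
`Θ` in `ℝ` rational half-lines determine them. Almost sure equality set by set then gives almost
sure equality of measures. -/
lemma eq_of_forall_annulus [BorelSpace Θ] [StandardBorelSpace Θ] (x₀ : Θ) {m m' : Measure Θ}
    (hm : FiniteOnBounded m)
    (huniv : ∀ k, m (annulus x₀ k) = m' (annulus x₀ k))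
    (h : ∀ (k : ℕ) (q : ℚ), m (embeddingReal Θ ⁻¹' Set.Iic (q : ℝ) ∩ annulus x₀ k) =
      m' (embeddingReal Θ ⁻¹' Set.Iic (q : ℝ) ∩ annulus x₀ k)) : m = m' := by
  have he := measurableEmbedding_embeddingReal Θ
  have key : ∀ k, m.restrict (annulus x₀ k) = m'.restrict (annulus x₀ k) := by
    intro k
    have : IsFiniteMeasure (m.restrict (annulus x₀ k)) :=
      ⟨by rw [Measure.restrict_apply_univ]; exact hm _ (isBounded_annulus x₀ k)⟩
    have hmap : (m.restrict (annulus x₀ k)).map (embeddingReal Θ) =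
        (m'.restrict (annulus x₀ k)).map (embeddingReal Θ) := by
      refine ext_of_generate_finite _
        ((BorelSpace.measurable_eq (α := ℝ)).trans Real.borel_eq_generateFrom_Iic_rat)
        Real.isPiSystem_Iic_rat ?_ ?_
      · intro s hs
        obtain ⟨q, rfl⟩ := Set.mem_iUnion.1 hs
        rw [he.map_apply, he.map_apply, Measure.restrict_apply (he.measurable measurableSet_Iic),
          Measure.restrict_apply (he.measurable measurableSet_Iic), h]
      · rw [he.map_apply, he.map_apply]
        simpa using huniv k
    exact he.map_injective hmap
  rw [← sum_restrict_annulus x₀ m, ← sum_restrict_annulus x₀ m']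
  simp_rw [key]

/-- If the law of a random measure is the law of a random atomic measure, then the atoms can be
sampled given the random measure. -/
lemma exists_atoms_kernel [BorelSpace Θ] [Nonempty Θ] [PolishSpace Θ] {Ω : Type*}
    [MeasurableSpace Ω] {P : Measure Ω} [IsProbabilityMeasure P] {X : Ω → Measure Θ}
    (hX : Measurable X)
    (hLF : ∀ᵐ ω ∂P, FiniteOnBounded (X ω))
    {σ : Measure ((ℕ → ℝ≥0) × (ℕ → Θ))} [IsProbabilityMeasure σ]
    (hσ : σ.map (fun q => atomicMeasure q.1 q.2) = P.map X) :
    ∃ K : Kernel Ω ((ℕ → ℝ≥0) × (ℕ → Θ)), IsMarkovKernel K ∧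
      ∀ᵐ q ∂(P ⊗ₘ K), X q.1 = atomicMeasure q.2.1 q.2.2 := by
  have hφ : Measurable fun q : (ℕ → ℝ≥0) × (ℕ → Θ) => atomicMeasure q.1 q.2 :=
    measurable_atomicMeasure measurable_fst measurable_snd
  -- The conditional law of the atoms given the measure that they form; its regular version exists
  -- because sequences of atoms form a standard Borel space.
  let K := condDistrib id (fun q : (ℕ → ℝ≥0) × (ℕ → Θ) => atomicMeasure q.1 q.2) σ
  have hK : (P.map X) ⊗ₘ K = σ.map fun q => (atomicMeasure q.1 q.2, q) := by
    rw [← hσ]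
    exact compProd_map_condDistrib aemeasurable_id
  have hφ2 : Measurable fun q : Ω × (ℕ → ℝ≥0) × (ℕ → Θ) => atomicMeasure q.2.1 q.2.2 :=
    hφ.comp measurable_snd
  refine ⟨K.comap X hX, inferInstance, ?_⟩
  -- The measure and atoms sampled from it have the joint law of `(atomicMeasure q, q)`, where
  -- equality is an identity. Working with one `B` at a time keeps the event measurable.
  have hB : ∀ B : Set Θ, MeasurableSet B →
      ∀ᵐ q ∂(P ⊗ₘ (K.comap X hX)), X q.1 B = atomicMeasure q.2.1 q.2.2 B := by
    intro B hB
    have hS : MeasurableSet {q : Measure Θ × (ℕ → ℝ≥0) × (ℕ → Θ) |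
        q.1 B = atomicMeasure q.2.1 q.2.2 B} :=
      measurableSet_eq_fun ((Measure.measurable_coe hB).comp measurable_fst)
        ((Measure.measurable_coe hB).comp (hφ.comp measurable_snd))
    have h1 : ∀ᵐ q ∂((P.map X) ⊗ₘ K), q.1 B = atomicMeasure q.2.1 q.2.2 B := by
      have hpm : Measurable fun q : (ℕ → ℝ≥0) × (ℕ → Θ) => (atomicMeasure q.1 q.2, q) :=
        hφ.prodMk measurable_id
      rw [hK]
      exact (ae_map_iff hpm.aemeasurable hS).2 (ae_of_all _ fun q => rfl)
    have h2 := ae_of_ae_map hX.aemeasurable ((Measure.ae_compProd_iff hS).1 h1)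
    refine (Measure.ae_compProd_iff (measurableSet_eq_fun ?_ ?_)).2 h2
    · exact (Measure.measurable_coe hB).comp (hX.comp measurable_fst)
    · exact (Measure.measurable_coe hB).comp hφ2
  obtain ⟨x₀⟩ := id ‹Nonempty Θ›
  have h1 : ∀ᵐ q ∂(P ⊗ₘ (K.comap X hX)), FiniteOnBounded (X q.1) := by
    refine (Measure.ae_compProd_iff
      ((hX.comp measurable_fst) measurableSet_finiteOnBounded)).2 ?_
    filter_upwards [hLF] with ω hω
    exact ae_of_all _ fun _ => hω
  have he := measurableEmbedding_embeddingReal Θ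
  filter_upwards [h1, ae_all_iff.2 fun k => hB _ (measurableSet_annulus x₀ k),
    ae_all_iff.2 fun k => ae_all_iff.2 fun q : ℚ => hB _
      ((he.measurable (measurableSet_Iic (a := (q : ℝ)))).inter (measurableSet_annulus x₀ k))]
    with q h2 h3 h4
  exact eq_of_forall_annulus x₀ h2 h3 h4

end Extension
end States

/-! ### Comparison of the Laplace functionals over the past. -/

section Representation

variable {Θ : Type*} [MetricSpace Θ] [MeasurableSpace Θ] [BorelSpace Θ] [Nonempty Θ]

/-- The autoregressive decomposition at the level of exponents: innovation plus thinning. -/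
lemma ncExponent_smul {Θ : Type*} [MeasurableSpace Θ] (H M : Measure Θ) (b c : ℝ≥0) (f : Θ → ℝ) :
    ncExponent H (b • M) c f = ncExponent H 0 c f +
      b * ∫⁻ x, ENNReal.ofReal (c * f x / (1 + c * f x)) ∂M := by
  have : b • M = (b : ℝ≥0∞) • M := rfl
  rw [ncExponent, ncExponent, this, lintegral_smul_measure, lintegral_zero_measure, add_zero,
    smul_eq_mul]

variable {Ω : Type*} [MeasurableSpace Ω] {P : Measure Ω} [IsProbabilityMeasure P] {H : Measure Θ}

/-- The Laplace functional of the past and the next state of the process. -/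
lemma IsMARG1.laplace_next {β c : ℕ → ℝ≥0} {W : ℕ → Ω → Measure Θ} (hW : IsMARG1 P H β c W)
    {t : ℕ} (ht : 1 ≤ t) {B : Set (Set.Icc 1 t → Measure Θ)} (hB : MeasurableSet B)
    {f : Θ → ℝ} (hf : f ∈ BMPlus Θ) :
    ∫⁻ ω, B.indicator 1 (past W t ω) * negExp (∫⁻ x, ENNReal.ofReal (f x) ∂(W (t + 1) ω)) ∂P =
      ∫⁻ g, B.indicator 1 g * negExp (ncExponent H (β (t + 1) • lastState ht g) (c (t + 1)) f)
        ∂(P.map (past W t)) := by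
  obtain ⟨κ, hκ, hκn, hκd⟩ := hW.transition t ht
  have hΨ : Measurable fun m : Measure Θ => negExp (∫⁻ x, ENNReal.ofReal (f x) ∂m) :=
    measurable_negExp.comp (measurable_lintegral_ofReal hf)
  have hB1 : Measurable (B.indicator (1 : (Set.Icc 1 t → Measure Θ) → ℝ≥0∞)) :=
    measurable_one.indicator hB
  have hF : Measurable fun q : (Set.Icc 1 t → Measure Θ) × Measure Θ =>
      B.indicator 1 q.1 * negExp (∫⁻ x, ENNReal.ofReal (f x) ∂q.2) :=
    (hB1.comp measurable_fst).mul (hΨ.comp measurable_snd)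
  have h1 := lintegral_map_past_next ht hκd hF
  rw [lintegral_map hF ((hW.measurable_past t).prodMk (hW.measurable (t + 1) (by omega)))] at h1
  rw [h1]
  have h2 : ∀ᵐ g ∂(P.map (past W t)),
      IsNcGammaProcessLaw H (β (t + 1) • lastState ht g) ((c (t + 1) : ℝ)⁻¹) (κ (lastState ht g)) ∧
        FiniteOnBounded (lastState ht g) := by
    rw [← map_lastState_past hW ht] at hκn
    have h3 := ae_map_finiteOnBounded (hW.measurable t ht) (hW.finiteOnBounded t ht)
    rw [← map_lastState_past hW ht] at h3
    exact (ae_of_ae_map (measurable_lastState ht).aemeasurable hκn).and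
      (ae_of_ae_map (measurable_lastState ht).aemeasurable h3)
  refine lintegral_congr_ae ?_
  filter_upwards [h2] with g hg
  rw [lintegral_const_mul _ hΨ]
  congr 1
  exact (isNcGammaProcessLaw_iff hW.base (hg.2.smul _) _ _).1 hg.1 f hf

/-- The Laplace functional of the past and of the thinned state plus innovation. -/
lemma IsThinningWithInnovation.laplace {b c : ℝ≥0} (hc : 0 < c) (hH : FiniteOnBounded H) {t : ℕ}
    (ht : 1 ≤ t) {X : ℕ → Ω → Measure Θ} {w : ℕ → Ω → ℝ≥0} {θ : ℕ → Ω → Θ} {wU : ℕ → Ω → ℝ≥0}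
    {WI : Ω → Measure Θ} (hX : IsThinningWithInnovation P H b c t X w θ wU WI)
    {B : Set (Set.Icc 1 t → Measure Θ)} (hB : MeasurableSet B) {f : Θ → ℝ} (hf : f ∈ BMPlus Θ) :
    ∫⁻ ω, B.indicator 1 (past X t ω) * negExp (∫⁻ x, ENNReal.ofReal (f x)
        ∂(atomicMeasure (fun i => wU i ω) (fun i => θ i ω) + WI ω)) ∂P =
      ∫⁻ g, B.indicator 1 g * negExp (ncExponent H (b • lastState ht g) c f)
        ∂(P.map (past X t)) := by
  have hfm := hf.1
  have hr : (0 : ℝ) < (c : ℝ)⁻¹ := inv_pos.2 hc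
  obtain ⟨h, hh, hlaw⟩ := exists_ncGammaLaw_zero_representation hr
  have hpast : Measurable (past X t) := MARG.measurable_past hX.measurable_past
  have hθ : Measurable fun ω => fun i => θ i ω := measurable_pi_lambda _ hX.measurable_atom
  have hw : Measurable fun ω => fun i => w i ω := measurable_pi_lambda _ hX.measurable_weight
  have hwU : Measurable fun ω => fun i => wU i ω := measurable_pi_lambda _ hX.measurable_thinned
  let 𝓖 : Type _ := (Set.Icc 1 t → Measure Θ) × (ℕ → ℝ≥0) × (ℕ → Θ)
  let G : Ω → 𝓖 := fun ω => (past X t ω, (fun i => w i ω), (fun i => θ i ω))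
  have hG : Measurable G := hpast.prodMk (hw.prodMk hθ)
  let weights : 𝓖 → ℕ → ℝ≥0 := fun g => g.2.1
  have hweights : Measurable weights := measurable_fst.comp measurable_snd
  -- From here the given thinned weights may be replaced, jointly with the past and atoms, by the
  -- uniform coupling.
  have hmap := (isThinnedWeights_iff_map_eq hr hh hlaw hG hweights hX.measurable_thinned).1
    hX.thinned
  have hB1 : Measurable (B.indicator (1 : (Set.Icc 1 t → Measure Θ) → ℝ≥0∞)) :=
    measurable_one.indicator hB
  have hΨ : Measurable fun m : Measure Θ => negExp (∫⁻ x, ENNReal.ofReal (f x) ∂m) :=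
    measurable_negExp.comp (measurable_lintegral_ofReal hf)
  let Φ : 𝓖 × (ℕ → ℝ≥0) → ℝ≥0∞ := fun q => B.indicator 1 q.1.1 *
    negExp (∑' i, (q.2 i : ℝ≥0∞) * ENNReal.ofReal (f (q.1.2.2 i)))
  have hΦ : Measurable Φ := by
    refine (hB1.comp (measurable_fst.comp measurable_fst)).mul
      (measurable_negExp.comp (Measurable.tsum fun i => ?_))
    have h1 : Measurable fun q : 𝓖 × (ℕ → ℝ≥0) => (q.2 i : ℝ≥0∞) :=
      ((measurable_pi_apply i).comp measurable_snd).coe_nnreal_ennreal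
    have h2 : Measurable fun q : 𝓖 × (ℕ → ℝ≥0) => ENNReal.ofReal (f (q.1.2.2 i)) :=
      (hfm.comp ((measurable_pi_apply i).comp
        (measurable_snd.comp (measurable_snd.comp measurable_fst)))).ennreal_ofReal
    exact h1.mul h2
  have hsplit : ∀ ω, B.indicator 1 (past X t ω) * negExp (∫⁻ x, ENNReal.ofReal (f x)
      ∂(atomicMeasure (fun i => wU i ω) (fun i => θ i ω) + WI ω)) =
      Φ (G ω, fun i => wU i ω) * negExp (∫⁻ x, ENNReal.ofReal (f x) ∂(WI ω)) := by
    intro ω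
    rw [lintegral_add_measure, negExp_add, lintegral_atomicMeasure _ _ hfm.ennreal_ofReal,
      ← mul_assoc]
  simp_rw [hsplit]
  have hGU : Measurable fun ω => (G ω, fun i => wU i ω) := hG.prodMk hwU
  have hindep : IndepFun (fun ω => Φ (G ω, fun i => wU i ω))
      (fun ω => negExp (∫⁻ x, ENNReal.ofReal (f x) ∂(WI ω))) P := by
    have hΦ' : Measurable fun q : (Set.Icc 1 t → Measure Θ) × (ℕ → ℝ≥0) × (ℕ → Θ) × (ℕ → ℝ≥0) =>
        Φ ((q.1, q.2.1, q.2.2.1), q.2.2.2) := by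
      refine hΦ.comp (Measurable.prodMk (measurable_fst.prodMk (Measurable.prodMk ?_ ?_)) ?_)
      · exact measurable_fst.comp measurable_snd
      · exact measurable_fst.comp (measurable_snd.comp measurable_snd)
      · exact measurable_snd.comp (measurable_snd.comp measurable_snd)
    exact hX.indep.symm.comp hΦ' hΨ
  have hmul := lintegral_mul_eq_lintegral_mul_lintegral_of_indepFun (hΦ.comp hGU)
    (hΨ.comp hX.measurable_innovation) hindep
  refine hmul.trans ?_
  have hI : ∫⁻ ω, negExp (∫⁻ x, ENNReal.ofReal (f x) ∂(WI ω)) ∂P = negExp (ncExponent H 0 c f) := by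
    have := Measure.isProbabilityMeasure_map (μ := P) hX.measurable_innovation.aemeasurable
    have h1 := (isNcGammaProcessLaw_iff hH FiniteOnBounded.zero c (P.map WI)).1
      (isGammaProcessLaw_iff_isNcGammaProcessLaw_zero.1 hX.innovation) f hf
    rwa [laplaceFunctional, lintegral_map hΨ hX.measurable_innovation] at h1
  -- Integrating out the uniforms leaves an integral against the atomic measure, which is the last
  -- state: the choice of atoms disappears.
  have hT : ∫⁻ ω, Φ (G ω, fun i => wU i ω) ∂P = ∫⁻ ω, B.indicator 1 (past X t ω) *
      negExp (b * ∫⁻ x, ENNReal.ofReal (c * f x / (1 + c * f x)) ∂(X t ω)) ∂P := by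
    have hcm : Measurable fun q : 𝓖 × (ℕ → unitInterval) => (q.1, couple h weights b q) :=
      measurable_fst.prodMk (measurable_couple hh hweights b)
    have := Measure.isProbabilityMeasure_map (μ := P) hG.aemeasurable
    have hη : Measurable fun x => ENNReal.ofReal (c * f x / (1 + c * f x)) := by fun_prop
    have hΦc : Measurable fun q : 𝓖 × (ℕ → unitInterval) => Φ (q.1, couple h weights b q) :=
      hΦ.comp hcm
    rw [← lintegral_map hΦ hGU, hmap, lintegral_map hΦ hcm, lintegral_prod _ hΦc.aemeasurable]
    have hin : ∀ g : 𝓖, ∫⁻ u, Φ (g, couple h weights b (g, u)) ∂uniformLaw =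
        B.indicator 1 g.1 * negExp (b * ∫⁻ x, ENNReal.ofReal (c * f x / (1 + c * f x))
          ∂(atomicMeasure g.2.1 g.2.2)) := by
      intro g
      have hm : Measurable fun u => negExp (∑' i, (couple h weights b (g, u) i : ℝ≥0∞) *
          ENNReal.ofReal (f (g.2.2 i))) := by
        have hcg : Measurable fun u => couple h weights b (g, u) :=
          (measurable_couple hh hweights b).comp measurable_prodMk_left
        refine measurable_negExp.comp (Measurable.tsum fun i => Measurable.mul_const ?_ _)
        exact ((measurable_pi_apply i).comp hcg).coe_nnreal_ennreal
      change ∫⁻ u, B.indicator 1 g.1 * negExp (∑' i, (couple h weights b (g, u) i : ℝ≥0∞) *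
          ENNReal.ofReal (f (g.2.2 i))) ∂uniformLaw = _
      rw [lintegral_const_mul _ hm, lintegral_negExp_couple hc hh hlaw g (fun i => f (g.2.2 i))
        fun i => hf.2.1 _, lintegral_atomicMeasure _ _ hη]
    simp_rw [hin]
    have hma : Measurable fun g : 𝓖 => B.indicator (1 : (Set.Icc 1 t → Measure Θ) → ℝ≥0∞) g.1 *
        negExp (b * ∫⁻ x, ENNReal.ofReal (c * f x / (1 + c * f x))
          ∂(atomicMeasure g.2.1 g.2.2)) := by
      refine (hB1.comp measurable_fst).mul (measurable_negExp.comp (Measurable.const_mul ?_ _))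
      exact (Measure.measurable_lintegral hη).comp (measurable_atomicMeasure
        (measurable_fst.comp measurable_snd) (measurable_snd.comp measurable_snd))
    rw [lintegral_map hma hG]
    refine lintegral_congr_ae ?_
    filter_upwards [hX.atomic] with ω hω
    rw [hω]
  have hlast : Measurable fun g : Set.Icc 1 t → Measure Θ =>
      B.indicator (1 : (Set.Icc 1 t → Measure Θ) → ℝ≥0∞) g *
        negExp (ncExponent H (b • lastState ht g) c f) := by
    simp_rw [ncExponent_smul]
    have hη : Measurable fun x => ENNReal.ofReal (c * f x / (1 + c * f x)) := by fun_prop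
    have := (Measure.measurable_lintegral hη).comp (measurable_lastState (Θ := Θ) ht)
    exact hB1.mul (measurable_negExp.comp ((this.const_mul _).const_add _))
  rw [lintegral_map hlast hpast]
  calc (∫⁻ ω, Φ (G ω, fun i => wU i ω) ∂P) *
        ∫⁻ ω, negExp (∫⁻ x, ENNReal.ofReal (f x) ∂(WI ω)) ∂P
      = ∫⁻ ω, (B.indicator 1 (past X t ω) *
          negExp (b * ∫⁻ x, ENNReal.ofReal (c * f x / (1 + c * f x)) ∂(X t ω))) *
            negExp (ncExponent H 0 c f) ∂P := by
        rw [hI, hT, lintegral_mul_const' _ _ (negExp_ne_top _)]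
    _ = _ := by
        refine lintegral_congr fun ω => ?_
        rw [ncExponent_smul, negExp_add, mul_assoc, mul_comm (negExp (b * _))]
        rfl

/-- Two random measures have the same joint law with random pasts that have the same law, if their
Laplace functionals on the events of the past are the same. -/
lemma map_prodMk_eq_of_laplace {Ω' 𝓧 : Type*} [MeasurableSpace Ω'] [MeasurableSpace 𝓧]
    {P' : Measure Ω'} [IsProbabilityMeasure P'] {Z : Ω → 𝓧} {Z' : Ω' → 𝓧} {Y : Ω → Measure Θ}
    {Y' : Ω' → Measure Θ} (hZ : Measurable Z) (hZ' : Measurable Z') (hY : Measurable Y)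
    (hY' : Measurable Y') (hLF : ∀ᵐ ω ∂P, FiniteOnBounded (Y ω))
    (heq : ∀ B : Set 𝓧, MeasurableSet B → ∀ f ∈ BMPlus Θ,
      ∫⁻ ω, B.indicator 1 (Z ω) * negExp (∫⁻ x, ENNReal.ofReal (f x) ∂(Y ω)) ∂P =
        ∫⁻ ω, B.indicator 1 (Z' ω) * negExp (∫⁻ x, ENNReal.ofReal (f x) ∂(Y' ω)) ∂P') :
    P.map (fun ω => (Z ω, Y ω)) = P'.map (fun ω => (Z' ω, Y' ω)) := by
  have := Measure.isProbabilityMeasure_map (μ := P) (hZ.prodMk hY).aemeasurable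
  have := Measure.isProbabilityMeasure_map (μ := P') (hZ'.prodMk hY').aemeasurable
  refine Measure.ext_prod fun {B E} hB hE => ?_
  -- The uniqueness theorem is for finite measures, so it applies on each event of the past, which
  -- gives equality on rectangles.
  have key : (P.restrict (Z ⁻¹' B)).map Y = (P'.restrict (Z' ⁻¹' B)).map Y' := by
    refine ext_of_laplaceFunctional (fun f hf => ?_)
      (ae_map_finiteOnBounded hY (ae_restrict_of_ae hLF))
    have hΨ : Measurable fun m : Measure Θ => negExp (∫⁻ x, ENNReal.ofReal (f x) ∂m) :=
      measurable_negExp.comp (measurable_lintegral_ofReal hf)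
    rw [laplaceFunctional, laplaceFunctional, lintegral_map hΨ hY, lintegral_map hΨ hY',
      ← lintegral_indicator (hZ hB), ← lintegral_indicator (hZ' hB)]
    convert heq B hB f hf using 2
    · ext ω
      by_cases hω : Z ω ∈ B <;> simp [hω]
    · ext ω
      by_cases hω : Z' ω ∈ B <;> simp [hω]
  have h1 := congrArg (fun μ => μ E) key
  simp only [Measure.map_apply hY hE, Measure.map_apply hY' hE, Measure.restrict_apply (hY hE),
    Measure.restrict_apply (hY' hE)] at h1
  rw [Measure.map_apply (hZ.prodMk hY) (hB.prod hE),
    Measure.map_apply (hZ'.prodMk hY') (hB.prod hE)]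
  convert h1 using 2
  · ext ω
    simp [and_comm]
  · ext ω
    simp [and_comm]

end Representation

/-! ### Construction of the extension and proof of the theorem. -/

/-- On an extension of the probability space, the current state has atoms, and the thinned weights
and the innovation exist. -/
theorem exists_isThinningWithInnovation {Θ : Type v} [MetricSpace Θ] [PolishSpace Θ] [Nonempty Θ]
    [MeasurableSpace Θ] [BorelSpace Θ] {Ω : Type u} [MeasurableSpace Ω] {P : Measure Ω}
    [IsProbabilityMeasure P] {H : Measure Θ} (hH : FiniteOnBounded H) (b : ℝ≥0) {c : ℝ≥0}
    (hc : 0 < c) {X : ℕ → Ω → Measure Θ} {t : ℕ} (ht : 1 ≤ t)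
    (hX : ∀ s, 1 ≤ s → s ≤ t → Measurable (X s)) (hLF : ∀ᵐ ω ∂P, FiniteOnBounded (X t ω))
    {σ : Measure ((ℕ → ℝ≥0) × (ℕ → Θ))} [IsProbabilityMeasure σ]
    (hσ : σ.map (fun q => atomicMeasure q.1 q.2) = P.map (X t)) :
    ∃ (Ω' : Type (max u v)) (_ : MeasurableSpace Ω') (P' : Measure Ω') (π : Ω' → Ω)
      (w : ℕ → Ω' → ℝ≥0) (θ : ℕ → Ω' → Θ) (wU : ℕ → Ω' → ℝ≥0) (WI : Ω' → Measure Θ),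
      IsProbabilityMeasure P' ∧ MeasurePreserving π P' P ∧
      IsThinningWithInnovation P' H b c t (fun s ω' => X s (π ω')) w θ wU WI := by
  have hr : (0 : ℝ) < (c : ℝ)⁻¹ := inv_pos.2 hc
  obtain ⟨h, hh, hlaw⟩ := exists_ncGammaLaw_zero_representation hr
  obtain ⟨K, hK, hKX⟩ := exists_atoms_kernel (hX t ht le_rfl) hLF hσ
  obtain ⟨Q, hQ⟩ : ∃ Q, IsGammaProcessLaw H (c : ℝ)⁻¹ Q := by
    obtain ⟨w, θ, -, -, hQ⟩ := exists_ncGammaProcess hH c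
    exact ⟨_, isGammaProcessLaw_iff_isNcGammaProcessLaw_zero.2 (hQ 0 FiniteOnBounded.zero)⟩
  have := hQ.isProbabilityMeasure
  let 𝓖 : Type _ := (Set.Icc 1 t → Measure Θ) × (ℕ → ℝ≥0) × (ℕ → Θ)
  let weights : 𝓖 → ℕ → ℝ≥0 := fun g => g.2.1
  have hweights : Measurable weights := measurable_fst.comp measurable_snd
  have hatoms : Measurable fun g : 𝓖 => g.2.2 := measurable_snd.comp measurable_snd
  let G₀ : Ω × (ℕ → ℝ≥0) × (ℕ → Θ) → 𝓖 := fun q => (past X t q.1, q.2.1, q.2.2)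
  have hG₀ : Measurable G₀ := ((measurable_past hX).comp measurable_fst).prodMk
    ((measurable_fst.comp measurable_snd).prodMk (measurable_snd.comp measurable_snd))
  let P₀ : Measure (Ω × (ℕ → ℝ≥0) × (ℕ → Θ)) := P ⊗ₘ K
  -- Sample atoms given `ω`, then independent uniforms for the thinning, then an independent
  -- innovation of law `Q`.
  let P' : Measure (((Ω × (ℕ → ℝ≥0) × (ℕ → Θ)) × (ℕ → unitInterval)) × Measure Θ) :=
    (P₀.prod uniformLaw).prod Q
  have hGu : Measurable fun q : (Ω × (ℕ → ℝ≥0) × (ℕ → Θ)) × (ℕ → unitInterval) =>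
    (G₀ q.1, q.2) := (hG₀.comp measurable_fst).prodMk measurable_snd
  have hcouple : Measurable fun q : (Ω × (ℕ → ℝ≥0) × (ℕ → Θ)) × (ℕ → unitInterval) =>
      couple h weights b (G₀ q.1, q.2) := (measurable_couple hh hweights b).comp hGu
  have hfst : MeasurePreserving Prod.fst P' (P₀.prod uniformLaw) := measurePreserving_fst
  have hfst₂ : MeasurePreserving Prod.fst (P₀.prod uniformLaw) P₀ := measurePreserving_fst
  have hfst₃ : MeasurePreserving Prod.fst P₀ P := ⟨measurable_fst, Measure.fst_compProd P K⟩
  have hff : MeasurePreserving (fun ω' => ω'.1.1) P' P₀ := hfst₂.comp hfst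
  have hG : Measurable fun ω' : ((Ω × (ℕ → ℝ≥0) × (ℕ → Θ)) × (ℕ → unitInterval)) × Measure Θ =>
    G₀ ω'.1.1 := hG₀.comp hff.measurable
  have hwU : ∀ i, Measurable fun ω' : ((Ω × (ℕ → ℝ≥0) × (ℕ → Θ)) × (ℕ → unitInterval)) ×
      Measure Θ => couple h weights b (G₀ ω'.1.1, ω'.1.2) i := fun i =>
    (measurable_pi_apply i).comp (hcouple.comp measurable_fst)
  refine ⟨_, inferInstance, P', fun ω' => ω'.1.1.1, fun i ω' => ω'.1.1.2.1 i,
    fun i ω' => ω'.1.1.2.2 i, fun i ω' => couple h weights b (G₀ ω'.1.1, ω'.1.2) i,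
    fun ω' => ω'.2, inferInstance, hfst₃.comp hff, ?_⟩
  refine
    { measurable_past := fun s hs hst => (hX s hs hst).comp (hfst₃.comp hff).measurable
      measurable_weight := fun i =>
        (measurable_pi_apply i).comp (hweights.comp hG)
      measurable_atom := fun i => (measurable_pi_apply i).comp (hatoms.comp hG)
      measurable_thinned := hwU
      measurable_innovation := measurable_snd
      atomic := hff.quasiMeasurePreserving.ae hKX
      thinned := ?_
      innovation := ?_
      indep := ?_ }
  · refine (isThinnedWeights_iff_map_eq (P := P') (G := fun ω' => G₀ ω'.1.1) hr hh hlaw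
      hG hweights hwU).2 ?_
    have h1 : (P'.map fun ω' => G₀ ω'.1.1) = P₀.map G₀ := by
      rw [← hff.map_eq, Measure.map_map hG₀ hff.measurable]
      rfl
    have h2 : (P₀.prod uniformLaw).map (fun q => (G₀ q.1, q.2)) = (P₀.map G₀).prod uniformLaw := by
      have := Measure.map_prod_map P₀ uniformLaw hG₀ measurable_id
      rw [Measure.map_id] at this
      exact this.symm
    have hcm : Measurable fun q : 𝓖 × (ℕ → unitInterval) => (q.1, couple h weights b q) :=
      measurable_fst.prodMk (measurable_couple hh hweights b)
    rw [h1, ← h2, ← hfst.map_eq, Measure.map_map hGu measurable_fst,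
      Measure.map_map hcm (hGu.comp measurable_fst)]
    rfl
  · have : P'.map (fun ω' => ω'.2) = Q := (measurePreserving_snd (μ := P₀.prod uniformLaw)).map_eq
    rwa [this]
  · have hY : Measurable fun q : (Ω × (ℕ → ℝ≥0) × (ℕ → Θ)) × (ℕ → unitInterval) =>
        ((G₀ q.1).1, (G₀ q.1).2.1, (G₀ q.1).2.2, couple h weights b (G₀ q.1, q.2)) :=
      (measurable_fst.comp (hG₀.comp measurable_fst)).prodMk
        ((hweights.comp (hG₀.comp measurable_fst)).prodMk
          ((measurable_snd.comp (measurable_snd.comp (hG₀.comp measurable_fst))).prodMk hcouple))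
    exact (indepFun_prod (μ := P₀.prod uniformLaw) (ν := Q) hY measurable_id).symm

end MARG

end

theorem proposition2 {Θ : Type v} [MetricSpace Θ] [PolishSpace Θ] [Nonempty Θ]
    [MeasurableSpace Θ] [BorelSpace Θ]
    {Ω : Type u} [MeasurableSpace Ω] (P : Measure Ω) [IsProbabilityMeasure P]
    (H : Measure Θ) (β c : ℕ → ℝ≥0) (W : ℕ → Ω → Measure Θ) (hW : MARG.IsMARG1 P H β c W)
    (t : ℕ) (ht : 1 ≤ t) (hatom : t = 1 → MARG.IsAtomic P (W 1)) :
    -- on some extension of the probability space, `W_t` has atoms, and the thinned weights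
    -- and the innovation exist
    (∃ (Ω' : Type (max u v)) (_ : MeasurableSpace Ω') (P' : Measure Ω') (π : Ω' → Ω)
      (w : ℕ → Ω' → ℝ≥0) (θ : ℕ → Ω' → Θ) (wU : ℕ → Ω' → ℝ≥0) (WI : Ω' → Measure Θ),
      IsProbabilityMeasure P' ∧ MeasurePreserving π P' P ∧
      MARG.IsThinningWithInnovation P' H (β (t + 1)) (c (t + 1)) t
        (fun s ω' => W s (π ω')) w θ wU WI) ∧
    -- whenever they are given, over any copy `(X_1, …, X_t)` of the past, thinning plus
    -- innovation has the law of `W_{t+1}`, jointly with the past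
    (∀ (Ω' : Type x) [MeasurableSpace Ω'] (P' : Measure Ω') [IsProbabilityMeasure P']
      (X : ℕ → Ω' → Measure Θ) (w : ℕ → Ω' → ℝ≥0) (θ : ℕ → Ω' → Θ) (wU : ℕ → Ω' → ℝ≥0)
      (WI : Ω' → Measure Θ),
      IdentDistrib (MARG.past X t) (MARG.past W t) P' P →
      MARG.IsThinningWithInnovation P' H (β (t + 1)) (c (t + 1)) t X w θ wU WI →
      IdentDistrib
        (fun ω' => (MARG.past X t ω',
          MARG.atomicMeasure (fun i => wU i ω') (fun i => θ i ω') + WI ω'))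
        (fun ω => (MARG.past W t ω, W (t + 1) ω)) P' P ∧
      ∀ i, P'⟦{ω' | wU i ω' = 0} | MeasurableSpace.comap (w i) inferInstance⟧ =ᵐ[P']
        fun ω' => Real.exp (-(β (t + 1) * w i ω' : ℝ))) := by
  constructor
  · obtain ⟨σ, hσ, hσm⟩ := hW.exists_atoms_law ht hatom
    exact MARG.exists_isThinningWithInnovation hW.base _ (hW.c_pos (t + 1) (by omega)) ht
      (fun s hs _ => hW.measurable s hs) (hW.finiteOnBounded t ht) hσm
  · intro Ω' _ P' _ X w θ wU WI hXW hX
    have hc := hW.c_pos (t + 1) (by omega)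
    have hpast : Measurable (MARG.past X t) := MARG.measurable_past hX.measurable_past
    have hw : Measurable fun ω => fun i => w i ω := measurable_pi_lambda _ hX.measurable_weight
    have hθ : Measurable fun ω => fun i => θ i ω := measurable_pi_lambda _ hX.measurable_atom
    have hwU : Measurable fun ω => fun i => wU i ω := measurable_pi_lambda _ hX.measurable_thinned
    have hY : Measurable fun ω' =>
        MARG.atomicMeasure (fun i => wU i ω') (fun i => θ i ω') + WI ω' := by
      have hA := MARG.measurable_atomicMeasure hwU hθ
      refine Measure.measurable_of_measurable_coe _ fun s hs => ?_
      simp_rw [Measure.add_apply]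
      exact ((Measure.measurable_coe hs).comp hA).add
        ((Measure.measurable_coe hs).comp hX.measurable_innovation)
    have hWn := hW.measurable (t + 1) (by omega)
    refine ⟨⟨(hpast.prodMk hY).aemeasurable, ((hW.measurable_past t).prodMk hWn).aemeasurable, ?_⟩,
      fun i => ?_⟩
    · refine (MARG.map_prodMk_eq_of_laplace (hW.measurable_past t) hpast hWn hY
        (hW.finiteOnBounded (t + 1) (by omega)) fun B hB f hf => ?_).symm
      -- Both sides integrate the same function of the past, so only the law of the past matters and
      -- a copy of it is enough.
      rw [hW.laplace_next ht hB hf, hX.laplace hc hW.base ht hB hf, hXW.map_eq]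
    · have hG : Measurable fun ω => (MARG.past X t ω, (fun i => w i ω), (fun i => θ i ω)) :=
        hpast.prodMk (hw.prodMk hθ)
      refine MARG.condExp_thinned_eq_zero hG.comap_le hX.thinned i ?_
      rw [← measurable_iff_comap_le]
      have h1 : Measurable fun g : (Set.Icc 1 t → Measure Θ) × (ℕ → ℝ≥0) × (ℕ → Θ) => g.2.1 i :=
        (measurable_pi_apply i).comp (measurable_fst.comp measurable_snd)
      exact h1.comp (comap_measurable _)
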